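/- Let $0<q<1$, $[k]=\frac{1-q^k}{1-q}$ for $k\ge 1$, and for $r\ge 1$ let $U_r\subset\mathbb{C}^r$ be the set of $(s_1,\dots,s_r)$ with $\mathrm{Re}(s_1+\dots+s_j)>0$ for $j=1,\dots,r$. The $q$-multiple zeta function of depth $r$ is the meromorphic function $\zeta_q(s_1,\dots,s_r)$ on $\mathbb{C}^r$ which on $U_r$ is the sum of the absolutely convergent series $$\zeta_q(s_1,\dots,s_r)=\sum_{k_1>\dots>k_r\ge1}\frac{q^{k_1s_1+\dots+k_rs_r}}{[k_1]^{s_1}\cdots[k_r]^{s_r}};$$ in depth $0$ put $\zeta_q(\,)=1$. For $i\ge 0$ let $q_i(t)=q^{-(t+i)}-1$, and for $n\ge1$ let $$\mathcal{L}_n(t)=\sum_{\substack{j\ge 0,\ i_1,\dots,i_j\ge1\\ i_1+\dots+i_j=n-1}}\ \prod_{u=1}^{j}\frac{1}{i_u!\;q_{i_1+\dots+i_{u-1}}(t)}$$ (the sum is over all ordered tuples of positive integers with sum $n-1$, so that $\mathcal{L}_1=1$). **Theorem.** (0) $\mathcal{L}_n$ is the function in the determinant formula: for $n\ge1$ and every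 $t\in\mathbb{C}$ with $q_0(t)\cdots q_{n-2}(t)\ne0$, $$D_{1,n}(t)=t(t+1)\cdots(t+n-2)\,\mathcal{L}_n(t),$$ where $D_{1,n}(t)$ is the determinant of size $n-1$ whose $(a,b)$ entry, $0\le a,b\le n-2$, is $(-1)^{b-a}\dfrac{(t+a)(t+a+1)\cdots(t+b)}{(b-a+1)!\,q_a(t)}$ for $a\le b$, is $1$ for $a=b+1$, and is $0$ for $a>b+1$ (for $n=1$ both sides are $1$). (1) For every $r\ge 0$ the series converges on $U_r$ and extends to a meromorphic function $\zeta_q$ on $\mathbb{C}^r$. (2) Let $r\ge1$ and $n\ge0$. Along the hyperplane $\mathcal{H}_{1,n}=\{s_1=-n\}$ of $\mathbb{C}^r$ the function $\zeta_q(s_1,\dots,s_r)$ has at most a simple pole, and its residue there, i.e. the restriction of the meromorphic function $(s_1+n)\,\zeta_q(s_1,\dots,s_r)$ to $\mathcal{H}_{1,n}$, is, as a meromorphic function on $\mathcal{H}_{1,n}$, the restriction to $\mathcal{H}_{1,n}$ of $$-\,n!\,\mathcal{L}_{n+1}(-n)\,\frac{\zeta_q(s_2,\dots,s_r)}{\log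 q}.$$ -/

import Mathlib

open Filter Topology

namespace QMZV

/-- The `q`-integer `[k] = (1 - q^k) / (1 - q)`. -/
noncomputable def qInt (q : ℝ) (k : ℕ) : ℝ := (1 - q ^ k) / (1 - q)

/-- The index set of the series: tuples `k₁ > ⋯ > k_r ≥ 1`. -/
abbrev Index (r : ℕ) : Type := {k : Fin r → ℕ // StrictAnti k ∧ ∀ i, 1 ≤ k i}

/-- The term `q^{k₁s₁ + ⋯ + k_r s_r} / ([k₁]^{s₁} ⋯ [k_r]^{s_r})` (principal powers of positive
reals). -/
noncomputable def term (q : ℝ) {r : ℕ} (s : Fin r → ℂ) (k : Index r) : ℂ :=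
  (q : ℂ) ^ (∑ i, (k.1 i : ℂ) * s i) / ∏ i, (qInt q (k.1 i) : ℂ) ^ (s i)

/-- The domain `U_r`: `Re (s₁ + ⋯ + s_j) > 0` for `j = 1, …, r`. -/
def domainU (r : ℕ) : Set (Fin r → ℂ) :=
  {s | ∀ j : Fin r, 0 < (∑ i ∈ Finset.Iic j, s i).re}

/-- Near `a`, `F` coincides with the quotient `f / g` of two holomorphic functions, `g` not
vanishing identically near `a`, outside the zero set of some holomorphic `h` that does not vanish
identically near `a`; that is, `f / g` is the germ at `a` of the meromorphic function `F`
(whose values on thin analytic sets are irrelevant). -/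
def IsFractionAt {d : ℕ} (F f g : (Fin d → ℂ) → ℂ) (a : Fin d → ℂ) : Prop :=
  AnalyticAt ℂ f a ∧ AnalyticAt ℂ g a ∧ (∃ᶠ s in 𝓝 a, g s ≠ 0) ∧
    ∃ h : (Fin d → ℂ) → ℂ, AnalyticAt ℂ h a ∧ (∃ᶠ s in 𝓝 a, h s ≠ 0) ∧
      ∀ᶠ s in 𝓝 a, h s ≠ 0 → g s ≠ 0 → F s = f s / g s

/-- `F` is a meromorphic function on `ℂ^d`: locally a quotient of holomorphic functions. -/
def IsMeromorphic {d : ℕ} (F : (Fin d → ℂ) → ℂ) : Prop :=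
  ∀ a, ∃ f g, IsFractionAt F f g a

/-- `Z` is (a representative of) the `q`-multiple zeta function of depth `r`: it is meromorphic on
`ℂ^r`, and on `U_r` it is the sum of the (absolutely convergent) defining series. In depth `0` this
is the constant `1`. -/
structure IsQMultiZeta (q : ℝ) (r : ℕ) (Z : (Fin r → ℂ) → ℂ) : Prop where
  meromorphic : IsMeromorphic Z
  hasSum : ∀ s ∈ domainU r, HasSum (term q s) (Z s)

/-- `R`, as a function of the coordinates `(s₂, …, s_{d+1})` on the hyperplane `s₁ = c`, is the
residue along this hyperplane of the meromorphic function `F` on `ℂ^{d+1}`: near every point of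
the hyperplane the meromorphic function `(s₁ - c) F` is a quotient `f / g` of holomorphic functions
whose denominator does not vanish identically on the hyperplane (so `F` has at most a simple pole
along it), and `R` is the restriction of `f / g` to the hyperplane. -/
def IsResidueAlong {d : ℕ} (F : (Fin (d + 1) → ℂ) → ℂ) (c : ℂ) (R : (Fin d → ℂ) → ℂ) : Prop :=
  ∀ b : Fin d → ℂ, ∃ f g : (Fin (d + 1) → ℂ) → ℂ,
    IsFractionAt (fun s => (s 0 - c) * F s) f g (Matrix.vecCons c b) ∧
    IsFractionAt R (fun y => f (Matrix.vecCons c y)) (fun y => g (Matrix.vecCons c y)) b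

/-- `q_i(t) = q^{-(t+i)} - 1`. -/
noncomputable def qFun (q : ℝ) (i : ℕ) (t : ℂ) : ℂ := (q : ℂ) ^ (-(t + i)) - 1

/-- The determinant `D_{1,n}(t)`, of size `n - 1`. With rows and columns numbered from `0`, the
entry in row `a` and column `b ≥ a` is
`(-1)^{b-a} (t+a)(t+a+1)⋯(t+b) / ((b-a+1)! q_a(t))`,
the entries just below the diagonal are `1`, and all other entries are `0`. -/
noncomputable def detD (q : ℝ) (n : ℕ) (t : ℂ) : ℂ :=
  (Matrix.of fun a b : Fin (n - 1) =>
    if a ≤ b then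
      (-1) ^ (b.1 - a.1) * (∏ l ∈ Finset.Icc a.1 b.1, (t + l)) /
        (((b.1 - a.1 + 1).factorial : ℂ) * qFun q a.1 t)
    else if a.1 = b.1 + 1 then 1 else 0).det

/-- The combinatorial function `𝓛_n(t)`: the sum over all ordered tuples `(i₁, …, i_j)` of positive
integers with `i₁ + ⋯ + i_j = n - 1` of
`∏_{u=1}^{j} 1 / (i_u! q_{i₁ + ⋯ + i_{u-1}}(t))`. In particular `𝓛_1 = 1`. -/
noncomputable def calL (q : ℝ) (n : ℕ) (t : ℂ) : ℂ :=
  ∑ c : Composition (n - 1), ∏ u : Fin c.length,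
    1 / (((c.blocksFun u).factorial : ℂ) * qFun q (c.sizeUpTo u) t)

end QMZV

/-! Up to the factor `∏ (1 - q) ^ s i`, the zeta series is the sum of `∏ q^{k_i s_i} (1 -
q^{k_i})^{-s_i}`. Expanding `(1 - q^{k₁})^{-s₁}` by the binomial series in `q^{k₁}` and summing the
resulting geometric series over `k₁ > k₂` yields a series over `m`: the binomial coefficient,
divided by `q_0(s₁ + m)`, times a series of depth one less in which `k₂` carries the extra exponent
`s₁ + m`. Allowing such a shift `c` from the start closes the recursion, which is `shiftedZeta`;
`hasSum_shiftedSeriesTerm` identifies it with the series. For `m` large the shift moves the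
lower-depth factor into its domain of convergence, and the tail is dominated by a binomial series at
`q`. Hence only finitely many terms can be singular near a given point, and the recursion continues
the series meromorphically (`fractionAlong_shiftedZeta`).

The zeros of `q_0` are purely imaginary, so along `s₁ = -n` only the term `m = n` has a vanishing
factor `q_0(s₁ + m)`. There `q_0(z)` behaves like `-z log q`, the binomial coefficient is `(-1)^n`,
and the remaining shift is `0`, so the residue is `-(1 - q)^{-n} (-1)^n ζ_q(s₂, …) / log q`
(`exists_residue_representative`). The binomial theorem gives `n! 𝓛_{n+1}(-n) = (-1 / (1 - q))^n`
(`factorial_mul_compositionSum`), which turns this into the stated form. The identity theorem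
`IsMeromorphic.genericEqAt` carries the result to every representative of the zeta function.

The determinant formula holds because expanding the determinant and splitting a composition at its
first block give the same recursion. -/

namespace QMZV

/-! ### Analyticity of normally convergent series in several variables -/

/-- Normally convergent series of vector-valued analytic functions on balls of `E` are analytic. -/
def NormalSumsAnalytic (E : Type) [NormedAddCommGroup E] [NormedSpace ℂ E] : Prop :=
  ∀ (F : Type) [NormedAddCommGroup F] [NormedSpace ℂ F] [CompleteSpace F]
    (ι : Type) (f : ι → E → F) (u : ι → ℝ) (a : E) (R : ℝ), 0 < R →
    (∀ i, AnalyticOnNhd ℂ (f i) (Metric.ball a R)) →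
    (∀ i, ∀ x ∈ Metric.ball a R, ‖f i x‖ ≤ u i) → Summable u →
    AnalyticAt ℂ (fun x => ∑' i, f i x) a

theorem normalSumsAnalytic_of_subsingleton (E : Type) [NormedAddCommGroup E] [NormedSpace ℂ E]
    [Subsingleton E] : NormalSumsAnalytic E := by
  intro F _ _ _ ι f u a R _ _ _ _
  have : (fun x => ∑' i, f i x) = fun _ => ∑' i, f i a := by
    funext x; rw [Subsingleton.elim x a]
  rw [this]
  exact analyticAt_const

theorem NormalSumsAnalytic.of_equiv {E E' : Type} [NormedAddCommGroup E] [NormedSpace ℂ E]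
    [NormedAddCommGroup E'] [NormedSpace ℂ E'] (h : NormalSumsAnalytic E) (e : E ≃L[ℂ] E') :
    NormalSumsAnalytic E' := by
  intro F _ _ _ ι f u a R hR hf hu hsu
  have hnhds : e ⁻¹' Metric.ball a R ∈ 𝓝 (e.symm a) :=
    e.continuous.continuousAt.preimage_mem_nhds (by simpa using Metric.ball_mem_nhds a hR)
  obtain ⟨r, hr, hsub⟩ := Metric.mem_nhds_iff.1 hnhds
  have key := h F ι (fun i x => f i (e x)) u (e.symm a) r hr
    (fun i x hx => (hf i (e x) (hsub hx)).comp (e.toContinuousLinearMap.analyticAt x))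
    (fun i x hx => hu i (e x) (hsub hx)) hsu
  have := key.comp (f := fun y => e.symm y) (e.symm.toContinuousLinearMap.analyticAt a)
  simpa [Function.comp_def] using! this

section Taylor

variable {E F : Type} [NormedAddCommGroup E] [NormedSpace ℂ E] [NormedAddCommGroup F]
  [NormedSpace ℂ F] [CompleteSpace F]

theorem analyticOnNhd_iteratedDeriv_fst {f : ℂ × E → F} {S : Set (ℂ × E)}
    (hf : AnalyticOnNhd ℂ f S) (hS : IsOpen S) (n : ℕ) :
    AnalyticOnNhd ℂ (fun p : ℂ × E => iteratedDeriv n (fun z => f (z, p.2)) p.1) S := by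
  induction n with
  | zero => simpa [iteratedDeriv_zero] using hf
  | succ n ih =>
    have h1 : AnalyticOnNhd ℂ (fun p : ℂ × E =>
        fderiv ℂ (fun p : ℂ × E => iteratedDeriv n (fun z => f (z, p.2)) p.1) p (1, 0)) S :=
      fun p hp => (ContinuousLinearMap.apply ℂ F ((1, 0) : ℂ × E)).analyticAt _ |>.comp
        (ih.fderiv p hp)
    refine h1.congr hS fun p hp => ?_
    have hd : HasFDerivAt (fun p : ℂ × E => iteratedDeriv n (fun z => f (z, p.2)) p.1)
      _ (p.1, p.2) := (ih p hp).differentiableAt.hasFDerivAt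
    have h2 : HasDerivAt (fun z : ℂ => (z, p.2)) ((1 : ℂ), (0 : E)) p.1 :=
      (hasDerivAt_id _).prodMk (hasDerivAt_const _ _)
    have h3 := hd.comp_hasDerivAt p.1 h2
    rw [iteratedDeriv_succ]
    exact h3.deriv.symm

end Taylor

/-- A Banach space containing countably many complemented copies of `F`, uniformly bounded. -/
theorem exists_banach_sequence_space (F : Type) [NormedAddCommGroup F] [NormedSpace ℂ F]
    [CompleteSpace F] : ∃ (X : Type) (_ : NormedAddCommGroup X) (_ : NormedSpace ℂ X)
      (_ : CompleteSpace X) (sgl : ℕ → F →L[ℂ] X) (ev : ℕ → X →L[ℂ] F),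
      (∀ n, ‖ev n‖ ≤ 1) ∧ (∀ n v, ‖sgl n v‖ = ‖v‖) ∧ (∀ n v, ev n (sgl n v) = v) ∧
        ∀ n m v, n ≠ m → ev n (sgl m v) = 0 := by
  have : Fact ((1 : ENNReal) ≤ 1) := ⟨le_rfl⟩
  refine ⟨lp (fun _ : ℕ => F) 1, inferInstance, inferInstance, inferInstance,
    lp.singleContinuousLinearMap ℂ (fun _ : ℕ => F) 1, lp.evalCLM ℂ (fun _ : ℕ => F) 1,
    fun n => ?_, fun n v => ?_, fun n v => ?_, fun n m v h => ?_⟩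
  · refine ContinuousLinearMap.opNorm_le_bound _ zero_le_one fun x => ?_
    rw [one_mul]
    exact lp.norm_apply_le_norm one_ne_zero x n
  · exact lp.norm_single (E := fun _ : ℕ => F) (p := 1) zero_lt_one n v
  · exact lp.single_apply_self (E := fun _ : ℕ => F) 1 n v
  · exact lp.single_apply_ne (E := fun _ : ℕ => F) 1 m v h

-- Expand each `f i` in a Taylor series in the first variable. Its coefficients are analytic in the
-- remaining variables, and all of them together form one normally convergent series with values in
-- a Banach sequence space. This is why the induction on dimension quantifies over all Banach
-- targets.
set_option maxHeartbeats 400000 in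
theorem NormalSumsAnalytic.prod {E : Type} [NormedAddCommGroup E] [NormedSpace ℂ E]
    (h : NormalSumsAnalytic E) : NormalSumsAnalytic (ℂ × E) := by
  rintro F _ _ _ ι f u ⟨z0, w0⟩ R hR hf hu hsu
  have hball : ∀ z w, z ∈ Metric.ball z0 R → w ∈ Metric.ball w0 R →
      (z, w) ∈ Metric.ball (z0, w0) R := fun z w hz hw => by
    rw [← ball_prod_same]; exact ⟨hz, hw⟩
  set ρ : ℝ := R / 2 with hρ
  have hρ0 : 0 < ρ := by positivity
  have hρR : ρ < R := by rw [hρ]; linarith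
  let c : ι → ℕ → E → F := fun i n w => (n.factorial : ℂ)⁻¹ • iteratedDeriv n (fun z => f i (z, w)) z0
  have hdiff : ∀ i, ∀ w ∈ Metric.ball w0 R,
      DifferentiableOn ℂ (fun z => f i (z, w)) (Metric.ball z0 R) := fun i w hw z hz =>
    ((hf i (z, w) (hball z w hz hw)).differentiableAt.comp z
      (by fun_prop : DifferentiableAt ℂ (fun z : ℂ => (z, w)) z)).differentiableWithinAt
  have hc_an : ∀ i n, AnalyticOnNhd ℂ (c i n) (Metric.ball w0 R) := fun i n w hw => by
    have h1 := analyticOnNhd_iteratedDeriv_fst (hf i) Metric.isOpen_ball n (z0, w)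
      (hball z0 w (Metric.mem_ball_self hR) hw)
    have h2 : AnalyticAt ℂ (fun w : E => (z0, w)) w := analyticAt_const.prod analyticAt_id
    exact (AnalyticAt.comp (f := fun w : E => (z0, w)) h1 h2).const_smul
  have hu0 : ∀ i, 0 ≤ u i := fun i =>
    (norm_nonneg _).trans (hu i (z0, w0) (Metric.mem_ball_self hR))
  have hc_le : ∀ i n, ∀ w ∈ Metric.ball w0 R, ‖c i n w‖ ≤ u i / ρ ^ n := fun i n w hw => by
    have hcl : DiffContOnCl ℂ (fun z => f i (z, w)) (Metric.ball z0 ρ) := by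
      refine DifferentiableOn.diffContOnCl ((hdiff i w hw).mono ?_)
      exact Metric.closure_ball_subset_closedBall.trans (Metric.closedBall_subset_ball hρR)
    have h1 := Complex.norm_iteratedDeriv_le_of_forall_mem_sphere_norm_le n hρ0 hcl (C := u i)
      fun z hz => hu i _ (hball z w
        (Metric.closedBall_subset_ball hρR (Metric.sphere_subset_closedBall hz)) hw)
    have hn : (0 : ℝ) < n.factorial := by positivity
    simp only [c, norm_smul, norm_inv, Complex.norm_natCast]
    rw [inv_mul_le_iff₀ hn]
    exact h1.trans_eq (by ring)
  obtain ⟨X, _, _, _, sgl, ev, hev, hsgl, hes, hes'⟩ := exists_banach_sequence_space F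
  -- Cauchy's estimate bounds the `n`-th coefficient by `u i / ρ ^ n`; the weight `(ρ / 2) ^ n`
  -- turns this into the summable bound `u i * (1 / 2) ^ n`.
  let g : ι × ℕ → E → X := fun p w => sgl p.2 ((ρ / 2 : ℂ) ^ p.2 • c p.1 p.2 w)
  have hsum2 : Summable fun p : ι × ℕ => u p.1 * (1 / 2 : ℝ) ^ p.2 :=
    hsu.mul_of_nonneg (summable_geometric_of_lt_one (by norm_num) (by norm_num)) hu0
      (fun n => by positivity)
  have hρn : ∀ n : ℕ, ‖(ρ / 2 : ℂ) ^ n‖ = (ρ / 2) ^ n := fun n => by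
    rw [norm_pow]; congr 1
    rw [norm_div, Complex.norm_real, Real.norm_of_nonneg hρ0.le]; simp
  have hcle2 : ∀ i n, ∀ w ∈ Metric.ball w0 R,
      ‖(ρ / 2 : ℂ) ^ n • c i n w‖ ≤ u i * (1 / 2 : ℝ) ^ n := fun i n w hw => by
    rw [norm_smul, hρn]
    refine (mul_le_mul_of_nonneg_left (hc_le i n w hw) (by positivity)).trans_eq ?_
    rw [div_pow, one_div, inv_pow]
    field_simp
  have hg_le : ∀ p, ∀ w ∈ Metric.ball w0 R, ‖g p w‖ ≤ u p.1 * (1 / 2 : ℝ) ^ p.2 :=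
    fun p w hw => by
      rw [hsgl]; exact hcle2 _ _ w hw
  have hG : AnalyticAt ℂ (fun w => ∑' p, g p w) w0 := by
    refine h X (ι × ℕ) g _ w0 R hR (fun p w hw => ?_) hg_le hsum2
    exact ((sgl p.2).analyticAt _).comp ((hc_an p.1 p.2 w hw).const_smul)
  -- `Λ t` sums a sequence as a power series in `t`. At `t = (z - z0) / (ρ / 2)` it undoes the
  -- weights and restores the Taylor series.
  let Λ : ℂ → X →L[ℂ] F := fun t => ∑' n : ℕ, t ^ n • ev n
  have hΛb : ∀ n : ℕ, ∀ t ∈ Metric.ball (0 : ℂ) (1 / 2), ‖t ^ n • ev n‖ ≤ (1 / 2 : ℝ) ^ n :=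
    fun n t ht => by
      rw [norm_smul, norm_pow]
      have : ‖t‖ ≤ 1 / 2 := by simpa using (mem_ball_zero_iff.1 ht).le
      calc ‖t‖ ^ n * ‖ev n‖ ≤ (1 / 2) ^ n * 1 := by gcongr; exact hev n
        _ = _ := mul_one _
  have hgeo : Summable fun n : ℕ => (1 / 2 : ℝ) ^ n :=
    summable_geometric_of_lt_one (by norm_num) (by norm_num)
  have hΛ : AnalyticAt ℂ Λ 0 := by
    have : DifferentiableOn ℂ Λ (Metric.ball 0 (1 / 2)) := by
      refine Complex.differentiableOn_tsum_of_summable_norm hgeo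
        (fun n => ?_) Metric.isOpen_ball hΛb
      exact ((differentiable_id.pow n).smul_const (ev n)).differentiableOn
    exact this.analyticAt (Metric.ball_mem_nhds _ (by norm_num))
  have hLG : AnalyticAt ℂ (fun p : ℂ × E => Λ ((p.1 - z0) / (ρ / 2)) (∑' k, g k p.2)) (z0, w0) := by
    have h1 : AnalyticAt ℂ (fun p : ℂ × E => Λ ((p.1 - z0) / (ρ / 2))) (z0, w0) := by
      have : AnalyticAt ℂ (fun p : ℂ × E => (p.1 - z0) / (ρ / 2)) (z0, w0) := by
        simp only [div_eq_mul_inv]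
        exact (analyticAt_fst.sub analyticAt_const).mul analyticAt_const
      refine AnalyticAt.comp (g := Λ) (f := fun p : ℂ × E => (p.1 - z0) / (ρ / 2)) ?_ this
      simpa using hΛ
    have h2 : AnalyticAt ℂ (fun p : ℂ × E => ∑' k, g k p.2) (z0, w0) :=
      AnalyticAt.comp (g := fun w => ∑' k, g k w) (f := fun p : ℂ × E => p.2) hG analyticAt_snd
    exact ((ContinuousLinearMap.id ℂ (X →L[ℂ] F)).analyticAt_bilinear _).comp₂ h1 h2
  refine hLG.congr ?_
  have hnb : Metric.ball z0 (ρ / 4) ×ˢ Metric.ball w0 R ∈ 𝓝 (z0, w0) :=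
    prod_mem_nhds (Metric.ball_mem_nhds _ (by positivity)) (Metric.ball_mem_nhds _ hR)
  filter_upwards [hnb] with p hp
  obtain ⟨hz, hw⟩ := hp
  have hρC : (ρ / 2 : ℂ) ≠ 0 := by
    have : (ρ : ℂ) ≠ 0 := by exact_mod_cast hρ0.ne'
    exact div_ne_zero this two_ne_zero
  set t : ℂ := (p.1 - z0) / (ρ / 2) with ht
  have htb : t ∈ Metric.ball (0 : ℂ) (1 / 2) := by
    rw [mem_ball_zero_iff, ht, norm_div, ← pow_one (ρ / 2 : ℂ), hρn, pow_one,
      div_lt_iff₀ (by positivity)]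
    rw [mem_ball_iff_norm] at hz
    linarith
  have hgs : Summable fun k => g k p.2 :=
    Summable.of_norm_bounded hsum2 fun k => hg_le k p.2 hw
  have hΛs : Summable fun n : ℕ => t ^ n • ev n :=
    Summable.of_norm_bounded hgeo fun n => hΛb n t htb
  have hΛg : ∀ k : ι × ℕ, Λ t (g k p.2) = (p.1 - z0) ^ k.2 • c k.1 k.2 p.2 := fun k => by
    have h1 : Λ t (g k p.2) = ∑' n : ℕ, (t ^ n • ev n) (g k p.2) :=
      (ContinuousLinearMap.apply ℂ F (g k p.2)).map_tsum hΛs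
    rw [h1, tsum_eq_single k.2]
    · change t ^ k.2 • ev k.2 (sgl k.2 _) = _
      rw [hes, smul_smul, ← mul_pow, ht, div_mul_cancel₀ _ hρC]
    · intro n hn
      change t ^ n • ev n (sgl k.2 _) = _
      rw [hes' _ _ _ hn, smul_zero]
  have hsumk : Summable fun k : ι × ℕ => (p.1 - z0) ^ k.2 • c k.1 k.2 p.2 := by
    simpa only [hΛg] using hgs.mapL (Λ t)
  rw [(Λ t).map_tsum hgs]
  simp only [hΛg]
  rw [hsumk.tsum_prod]
  refine tsum_congr fun i => ?_
  have hz' : p.1 ∈ Metric.ball z0 R := Metric.ball_subset_ball (by linarith) hz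
  have := (Complex.hasSum_taylorSeries_on_ball (hdiff i p.2 hw) hz').tsum_eq
  rw [← this]
  refine tsum_congr fun n => ?_
  simp only [c]
  rw [smul_comm]

theorem normalSumsAnalytic_pi (d : ℕ) : NormalSumsAnalytic (Fin d → ℂ) := by
  induction d with
  | zero => exact normalSumsAnalytic_of_subsingleton _
  | succ d ih => exact ih.prod.of_equiv (Fin.consEquivL ℂ fun _ => ℂ)

theorem normalSumsAnalytic_of_finiteDimensional (E : Type) [NormedAddCommGroup E]
    [NormedSpace ℂ E] [FiniteDimensional ℂ E] : NormalSumsAnalytic E :=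
  (normalSumsAnalytic_pi (Module.finrank ℂ E)).of_equiv
    (ContinuousLinearEquiv.ofFinrankEq (by simp))

/-! ### Hessenberg determinants -/

section Hessenberg

/-- The upper Hessenberg matrix with subdiagonal entries `1` and entries `f a b` for `a ≤ b`. -/
def hessenberg (N : ℕ) (f : ℕ → ℕ → ℂ) : Matrix (Fin N) (Fin N) ℂ :=
  Matrix.of fun a b => if a ≤ b then f a b else if a.1 = b.1 + 1 then 1 else 0

/-- `f` with its first row replaced by `v`. -/
def withTopRow (v : ℕ → ℂ) (f : ℕ → ℕ → ℂ) (a b : ℕ) : ℂ := if a = 0 then v b else f a b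

theorem hessenberg_apply (N : ℕ) (f : ℕ → ℕ → ℂ) (a b : Fin N) :
    hessenberg N f a b = if a.1 ≤ b.1 then f a b else if a.1 = b.1 + 1 then 1 else 0 := rfl

/-- The first column has only two nonzero entries, `v 0` and the subdiagonal `1`. Deleting the
second row leaves a Hessenberg matrix whose top row is `v` shifted by one, so the family with free
top row is closed under expansion. -/
theorem det_hessenberg_succ_succ (N : ℕ) (v : ℕ → ℂ) (f : ℕ → ℕ → ℂ) :
    (hessenberg (N + 2) (withTopRow v f)).det =
      v 0 * (hessenberg (N + 1) fun a b => f (a + 1) (b + 1)).det -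
      (hessenberg (N + 1) (withTopRow (fun b => v (b + 1)) fun a b => f (a + 1) (b + 1))).det := by
  have h1 : (hessenberg (N + 2) (withTopRow v f)).submatrix (Fin.succAbove 0) Fin.succ =
      hessenberg (N + 1) fun a b => f (a + 1) (b + 1) := by
    ext a b
    simp [hessenberg_apply, withTopRow]
  have h2 : (hessenberg (N + 2) (withTopRow v f)).submatrix
      (Fin.succAbove (Fin.succ (0 : Fin (N + 1)))) Fin.succ =
      hessenberg (N + 1) (withTopRow (fun b => v (b + 1)) fun a b => f (a + 1) (b + 1)) := by
    ext a b
    rw [Matrix.submatrix_apply, hessenberg_apply, hessenberg_apply]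
    rcases Fin.eq_zero_or_eq_succ a with rfl | ⟨a, rfl⟩
    · have : (Fin.succ (0 : Fin (N + 1))).succAbove (0 : Fin (N + 1)) = 0 :=
        Fin.succ_succAbove_zero _
      rw [this]
      simp [withTopRow]
    · have : (Fin.succ (0 : Fin (N + 1))).succAbove a.succ = a.succ.succ := by
        rw [Fin.succ_succAbove_succ, Fin.succAbove_zero]
      rw [this]
      simp [withTopRow]
  rw [Matrix.det_succ_column_zero, Fin.sum_univ_succ, Fin.sum_univ_succ, h1, h2,
    Finset.sum_eq_zero]
  · simp [hessenberg_apply, withTopRow, sub_eq_add_neg]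
  · intro a _
    simp [hessenberg_apply]

theorem det_hessenberg_withTopRow (N : ℕ) (v : ℕ → ℂ) (f : ℕ → ℕ → ℂ) :
    (hessenberg (N + 1) (withTopRow v f)).det = ∑ b ∈ Finset.range (N + 1),
      (-1) ^ b * v b * (hessenberg (N - b) fun a c => f (a + (b + 1)) (c + (b + 1))).det := by
  induction N generalizing v f with
  | zero => simp [hessenberg, withTopRow]
  | succ N ih =>
    rw [det_hessenberg_succ_succ, ih, Finset.sum_range_succ' _ (N + 1)]
    simp only [Nat.sub_zero, pow_zero, one_mul, zero_add]
    rw [sub_eq_add_neg, add_comm, ← Finset.sum_neg_distrib]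
    refine congrArg₂ _ (Finset.sum_congr rfl fun b _ => ?_) rfl
    rw [pow_succ, Nat.add_sub_add_right]
    simp only [add_assoc, add_comm 1]
    ring

theorem det_hessenberg_succ (N : ℕ) (f : ℕ → ℕ → ℂ) :
    (hessenberg (N + 1) f).det = ∑ b ∈ Finset.range (N + 1),
      (-1) ^ b * f 0 b * (hessenberg (N - b) fun a c => f (a + (b + 1)) (c + (b + 1))).det := by
  have h : withTopRow (f 0) f = f := by
    funext a b
    unfold withTopRow
    split_ifs with h
    · rw [h]
    · rfl
  conv_lhs => rw [← h]
  exact det_hessenberg_withTopRow N (f 0) f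

end Hessenberg

/-! ### The combinatorial function as a recursion over compositions -/

section Compositions

/-- Prepending a positive block to a composition. -/
def consComposition {m : ℕ} (i : ℕ) (hi : 0 < i) (c : Composition m) : Composition (i + m) where
  blocks := i :: c.blocks
  blocks_pos := by
    intro j hj
    rcases List.mem_cons.1 hj with rfl | h
    · exact hi
    · exact c.blocks_pos h
  blocks_sum := by simp [c.blocks_sum]

/-- The weight `∏ 1 / (i_u! q_{i₁ + ⋯ + i_{u-1}}(t))` of a list of blocks. -/
noncomputable def blockWeight (q : ℝ) : ℂ → List ℕ → ℂ
  | _, [] => 1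
  | t, i :: l => 1 / ((i.factorial : ℂ) * qFun q 0 t) * blockWeight q (t + i) l

theorem qFun_add (q : ℝ) (i j : ℕ) (t : ℂ) : qFun q (i + j) t = qFun q j (t + i) := by
  unfold qFun; push_cast; ring_nf

theorem blockWeight_eq_prod (q : ℝ) (t : ℂ) (l : List ℕ) :
    blockWeight q t l = ∏ u : Fin l.length,
      1 / (((l[u]).factorial : ℂ) * qFun q ((l.take u).sum) t) := by
  induction l generalizing t with
  | nil => simp [blockWeight]
  | cons i l ih =>
    rw [blockWeight, ih]
    simp only [List.length_cons]
    rw [Fin.prod_univ_succ]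
    simp [qFun_add]

/-- The sum of the weights of all compositions of `n`. -/
noncomputable def compositionSum (q : ℝ) (n : ℕ) (t : ℂ) : ℂ :=
  ∑ c : Composition n, blockWeight q t c.blocks

theorem calL_succ_eq (q : ℝ) (n : ℕ) (t : ℂ) : calL q (n + 1) t = compositionSum q n t := by
  unfold calL compositionSum
  refine Finset.sum_congr rfl fun c _ => ?_
  rw [blockWeight_eq_prod]
  rfl

theorem compositionSum_zero (q : ℝ) (t : ℂ) : compositionSum q 0 t = 1 := by
  have h : ∀ c : Composition 0, c.blocks = [] := fun c => by
    refine List.eq_nil_iff_forall_not_mem.2 fun i hi => ?_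
    have h1 := c.blocks_pos hi
    have h2 := List.le_sum_of_mem hi
    have h3 := c.blocks_sum
    omega
  have : Subsingleton (Composition 0) := ⟨fun c c' => Composition.ext ((h c).trans (h c').symm)⟩
  unfold compositionSum
  rw [Fintype.sum_subsingleton _ (Composition.ones 0), h, blockWeight]

/-- Split off the first block, of size `b + 1`. The partial sums in the remaining factors then
become a translation of `t` by `b + 1`. -/
theorem compositionSum_succ (q : ℝ) (n : ℕ) (t : ℂ) :
    compositionSum q (n + 1) t = ∑ b ∈ Finset.range (n + 1),
      1 / (((b + 1).factorial : ℂ) * qFun q 0 t) * compositionSum q (n - b) (t + (b + 1 : ℕ)) := by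
  unfold compositionSum
  simp only [Finset.mul_sum]
  rw [Finset.sum_sigma']
  symm
  refine Finset.sum_bij
    (fun x hx => (consComposition (x.1 + 1) x.1.succ_pos x.2).cast (by
      have := Finset.mem_range.1 (Finset.mem_sigma.1 hx).1; omega)) ?_ ?_ ?_ ?_
  · intro x _; exact Finset.mem_univ _
  · rintro ⟨b, c⟩ hx ⟨b', c'⟩ hx' h
    have h1 := congrArg Composition.blocks h
    simp only [Composition.cast, consComposition, List.cons.injEq, Nat.add_right_cancel_iff] at h1
    obtain ⟨rfl, h2⟩ := h1
    have : c = c' := Composition.ext h2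
    rw [this]
  · intro c _
    rcases hb : c.blocks with _ | ⟨i, l⟩
    · have := c.blocks_sum
      simp [hb] at this
    · have hi : 0 < i := c.blocks_pos (by simp [hb])
      have hs : i + l.sum = n + 1 := by simpa [hb] using c.blocks_sum
      refine ⟨⟨i - 1, ⟨l, fun h => c.blocks_pos (by simp [hb, h]), by omega⟩⟩, ?_, ?_⟩
      · simp; omega
      · apply Composition.ext
        simp [Composition.cast, consComposition, hb, Nat.sub_add_cancel hi]
  · rintro ⟨b, c⟩ hx
    simp [Composition.cast, consComposition, blockWeight]

end Compositions

theorem detD_succ_eq (q : ℝ) (n : ℕ) (t : ℂ) :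
    detD q (n + 1) t = (∏ l ∈ Finset.range n, (t + l)) * compositionSum q n t := by
  have key : ∀ (n : ℕ) (t : ℂ), (hessenberg n fun a b => (-1) ^ (b - a) * (∏ l ∈ Finset.Icc a b, (t + l)) /
      (((b - a + 1).factorial : ℂ) * qFun q a t)).det =
        (∏ l ∈ Finset.range n, (t + l)) * compositionSum q n t := by
    intro n
    induction n using Nat.strong_induction_on with
    | _ n ih =>
      intro t
      rcases n with _ | n
      · simp [compositionSum_zero, hessenberg]
      · rw [det_hessenberg_succ, compositionSum_succ, Finset.mul_sum]
        refine Finset.sum_congr rfl fun b hb => ?_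
        have hb' : b ≤ n := by simpa [Nat.lt_succ_iff] using hb
        have h1 := ih (n - b) (by omega) (t + (b + 1 : ℕ))
        have h2 : (hessenberg (n - b) fun a c => (-1) ^ (c + (b + 1) - (a + (b + 1))) *
            (∏ l ∈ Finset.Icc (a + (b + 1)) (c + (b + 1)), (t + l)) /
            (((c + (b + 1) - (a + (b + 1)) + 1).factorial : ℂ) * qFun q (a + (b + 1)) t)) =
            hessenberg (n - b) fun a c => (-1) ^ (c - a) *
              (∏ l ∈ Finset.Icc a c, (t + (b + 1 : ℕ) + l)) /
              (((c - a + 1).factorial : ℂ) * qFun q a (t + (b + 1 : ℕ))) := by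
          congr 1
          funext a c
          rw [Nat.add_sub_add_right, add_comm a (b + 1), qFun_add, add_comm c (b + 1),
            ← Finset.image_add_left_Icc, Finset.prod_image (by intro x _ y _ h; simpa using h)]
          congr 2
          refine congrArg _ (funext fun l => ?_)
          push_cast; ring
        rw [h2, h1]
        have h3 : ∏ l ∈ Finset.range (n + 1), (t + (l : ℂ)) = (∏ l ∈ Finset.Icc 0 b, (t + (l : ℂ))) *
            ∏ l ∈ Finset.range (n - b), (t + (b + 1 : ℕ) + (l : ℂ)) := by
          have : n + 1 = (b + 1) + (n - b) := by omega
          rw [this, Finset.prod_range_add, ← Nat.range_succ_eq_Icc_zero]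
          congr 1
          refine Finset.prod_congr rfl fun l _ => ?_
          push_cast; ring
        rw [h3, Nat.sub_zero]
        -- The sign of the expansion cancels the sign `(-1)^{b-a}` of the entry in row `a = 0`.
        have h4 : ((-1 : ℂ)) ^ b * (-1) ^ b = 1 := by rw [← mul_pow]; simp
        linear_combination ((∏ l ∈ Finset.Icc 0 b, (t + (l : ℂ))) /
            (((b + 1).factorial : ℂ) * qFun q 0 t) *
          (∏ l ∈ Finset.range (n - b), (t + (b + 1 : ℕ) + (l : ℂ))) *
          compositionSum q (n - b) (t + (b + 1 : ℕ))) * h4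
  exact key n t

/-- Put `x = -1 / (1 - q)`. Splitting off the first block at `t = -(n + 1)` leads again to negative
integers, and by induction the sum is `((1 + x)^{n+1} - x^{n+1}) / (q^{n+1} - 1)`. Since `1 + x = q
x`, this equals `x^{n+1}`. -/
theorem factorial_mul_compositionSum (q : ℝ) (hq0 : 0 < q) (hq1 : q < 1) (n : ℕ) :
    (n.factorial : ℂ) * compositionSum q n (-(n : ℂ)) = (-1 / (1 - q)) ^ n := by
  have hqc : (1 - q : ℂ) ≠ 0 := by
    rw [sub_ne_zero]; exact_mod_cast hq1.ne'
  induction n using Nat.strong_induction_on with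
  | _ n ih =>
    rcases n with _ | n
    · simp [compositionSum_zero]
    · have hq' : qFun q 0 (-((n + 1 : ℕ) : ℂ)) = (q : ℂ) ^ (n + 1) - 1 := by
        simp only [qFun, Nat.cast_zero, add_zero, neg_neg, Complex.cpow_natCast]
      have hne : (q : ℂ) ^ (n + 1) - 1 ≠ 0 := by
        rw [sub_ne_zero]
        exact_mod_cast (pow_lt_one₀ hq0.le hq1 (Nat.succ_ne_zero n)).ne
      have hterm : ∀ b ∈ Finset.range (n + 1), ((n + 1).factorial : ℂ) *
          (1 / (((b + 1).factorial : ℂ) * qFun q 0 (-((n + 1 : ℕ) : ℂ))) *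
            compositionSum q (n - b) (-((n + 1 : ℕ) : ℂ) + (b + 1 : ℕ))) =
          1 / ((q : ℂ) ^ (n + 1) - 1) *
            ((-1 / (1 - q)) ^ (n - b) * ((n + 1).choose (b + 1) : ℂ)) := by
        intro b hb
        have hb' : b ≤ n := by simpa [Nat.lt_succ_iff] using hb
        have h1 : (-((n + 1 : ℕ) : ℂ) + (b + 1 : ℕ)) = -((n - b : ℕ) : ℂ) := by
          push_cast [Nat.cast_sub hb']; ring
        have h2 := ih (n - b) (by omega)
        have h3 : ((n + 1).factorial : ℂ) =
            (n + 1).choose (b + 1) * (b + 1).factorial * (n - b).factorial := by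
          have := Nat.choose_mul_factorial_mul_factorial (n := n + 1) (k := b + 1) (by omega)
          rw [Nat.add_sub_add_right] at this
          exact_mod_cast this.symm
        have h4 : ((b + 1).factorial : ℂ) ≠ 0 := by exact_mod_cast (b + 1).factorial_ne_zero
        rw [hq', h1, h3, ← h2]
        field_simp
      rw [compositionSum_succ, Finset.mul_sum, Finset.sum_congr rfl hterm, ← Finset.mul_sum]
      have hbin := add_pow (1 : ℂ) (-1 / (1 - q)) (n + 1)
      rw [Finset.sum_range_succ'] at hbin
      simp only [one_pow, one_mul, Nat.add_sub_add_right, Nat.sub_zero, Nat.choose_zero_right,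
        Nat.cast_one, mul_one] at hbin
      have h5 : (1 : ℂ) + -1 / (1 - q) = q * (-1 / (1 - q)) := by field_simp; ring
      rw [h5, mul_pow] at hbin
      rw [one_div, inv_mul_eq_div, div_eq_iff hne]
      linear_combination -hbin

/-! ### Germs, thin sets and the identity theorem for meromorphic functions -/

section Germs

variable {E : Type*} [NormedAddCommGroup E] [NormedSpace ℂ E]

theorem frequently_ne_zero_of_ball {h : E → ℂ} {a : E} {R : ℝ}
    (hh : AnalyticOnNhd ℂ h (Metric.ball a R)) {x y : E} (hx : x ∈ Metric.ball a R)
    (hx0 : h x ≠ 0) (hy : y ∈ Metric.ball a R) : ∃ᶠ s in 𝓝 y, h s ≠ 0 := by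
  intro hev
  have hz : h =ᶠ[𝓝 y] 0 := hev.mono fun s hs => not_not.1 hs
  exact hx0 (hh.eqOn_zero_of_preconnected_of_eventuallyEq_zero
    (convex_ball a R).isPreconnected hy hz hx)

theorem exists_ball_of_analyticAt {h : E → ℂ} {a : E} (hh : AnalyticAt ℂ h a) {p : E → Prop}
    (hp : ∀ᶠ s in 𝓝 a, p s) :
    ∃ R > 0, AnalyticOnNhd ℂ h (Metric.ball a R) ∧ ∀ s ∈ Metric.ball a R, p s := by
  obtain ⟨R, hR, hsub⟩ := Metric.eventually_nhds_iff_ball.1 (hh.eventually_analyticAt.and hp)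
  exact ⟨R, hR, fun s hs => (hsub s hs).1, fun s hs => (hsub s hs).2⟩

/-- Germs of holomorphic functions form an integral domain: near a point where `g` is nonzero, `g`
stays nonzero, while `h` cannot vanish identically there by the identity theorem on a ball. -/
theorem frequently_mul_ne_zero {g h : E → ℂ} {a : E} (hg : AnalyticAt ℂ g a)
    (hh : AnalyticAt ℂ h a) (hg0 : ∃ᶠ s in 𝓝 a, g s ≠ 0) (hh0 : ∃ᶠ s in 𝓝 a, h s ≠ 0) :
    ∃ᶠ s in 𝓝 a, g s * h s ≠ 0 := by
  obtain ⟨R, hR, hhR, hgR⟩ := exists_ball_of_analyticAt hh hg.eventually_analyticAt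
  have hball := Metric.ball_mem_nhds a hR
  refine frequently_iff.2 fun {U} hU => ?_
  obtain ⟨x, hx, hxU⟩ := (hg0.and_eventually (Filter.inter_mem hball
    (eventually_mem_nhds_iff.2 hU))).exists
  obtain ⟨z, hz⟩ := (hh0.and_eventually hball).exists
  have h1 := frequently_ne_zero_of_ball hhR hz.2 hz.1 hxU.1
  have h2 : ∀ᶠ s in 𝓝 x, g s ≠ 0 := (hgR x hxU.1).continuousAt.eventually_ne hx
  obtain ⟨s, hs⟩ := ((h1.and_eventually h2).and_eventually hxU.2).exists
  exact ⟨s, hs.2, mul_ne_zero hs.1.2 hs.1.1⟩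

/-- `F` and `G` agree near `a` outside the zero set of a nonzero holomorphic germ. -/
def GenericEqAt (F G : E → ℂ) (a : E) : Prop :=
  ∃ h : E → ℂ, AnalyticAt ℂ h a ∧ (∃ᶠ s in 𝓝 a, h s ≠ 0) ∧ ∀ᶠ s in 𝓝 a, h s ≠ 0 → F s = G s

theorem isOpen_setOf_genericEqAt (F G : E → ℂ) : IsOpen {a | GenericEqAt F G a} := by
  rw [isOpen_iff_mem_nhds]
  rintro a ⟨h, hh, hh0, hFG⟩
  obtain ⟨R, hR, hhR, hFGR⟩ := exists_ball_of_analyticAt hh hFG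
  have hball := Metric.ball_mem_nhds a hR
  obtain ⟨z, hz⟩ := (hh0.and_eventually hball).exists
  filter_upwards [hball] with y hy
  exact ⟨h, hhR y hy, frequently_ne_zero_of_ball hhR hz.2 hz.1 hy,
    Filter.mem_of_superset (Metric.isOpen_ball.mem_nhds hy) hFGR⟩

end Germs

theorem IsFractionAt.congr {d : ℕ} {F G f g : (Fin d → ℂ) → ℂ} {a : Fin d → ℂ}
    (h : IsFractionAt G f g a) (hFG : GenericEqAt F G a) : IsFractionAt F f g a := by
  obtain ⟨hf, hg, hg0, h, hh, hh0, hG⟩ := h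
  obtain ⟨k, hk, hk0, hk'⟩ := hFG
  refine ⟨hf, hg, hg0, fun s => h s * k s, hh.mul hk, frequently_mul_ne_zero hh hk hh0 hk0, ?_⟩
  filter_upwards [hG, hk'] with s h1 h2 h3 h4
  rw [h2 (right_ne_zero_of_mul h3), h1 (left_ne_zero_of_mul h3) h4]

theorem genericEqAt_of_mem_closure {d : ℕ} {F G : (Fin d → ℂ) → ℂ} (hF : IsMeromorphic F)
    (hG : IsMeromorphic G) {a : Fin d → ℂ} (ha : a ∈ closure {a | GenericEqAt F G a}) :
    GenericEqAt F G a := by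
  obtain ⟨f, g, hf, hg, hg0, h, hh, hh0, hFe⟩ := hF a
  obtain ⟨f', g', hf', hg', hg0', h', hh', hh0', hGe⟩ := hG a
  -- Off the zeros of `H` both fraction representations are valid, so `F = G` becomes the vanishing
  -- of the cross-multiplied `P`, which is holomorphic.
  let H : (Fin d → ℂ) → ℂ := fun s => (h s * g s) * (h' s * g' s)
  let P : (Fin d → ℂ) → ℂ := fun s => f s * g' s - f' s * g s
  have hH : AnalyticAt ℂ H a := (hh.mul hg).mul (hh'.mul hg')
  have hH0 : ∃ᶠ s in 𝓝 a, H s ≠ 0 :=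
    frequently_mul_ne_zero (hh.mul hg) (hh'.mul hg') (frequently_mul_ne_zero hh hg hh0 hg0)
      (frequently_mul_ne_zero hh' hg' hh0' hg0')
  have hP : AnalyticAt ℂ P a := (hf.mul hg').sub (hf'.mul hg)
  have hev : ∀ᶠ s in 𝓝 a, H s ≠ 0 → (F s = G s ↔ P s = 0) := by
    filter_upwards [hFe, hGe] with s h1 h2 h3
    have hg1 := right_ne_zero_of_mul (left_ne_zero_of_mul h3)
    have hg2 := right_ne_zero_of_mul (right_ne_zero_of_mul h3)
    rw [h1 (left_ne_zero_of_mul (left_ne_zero_of_mul h3)) hg1,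
      h2 (left_ne_zero_of_mul (right_ne_zero_of_mul h3)) hg2, div_eq_div_iff hg1 hg2, sub_eq_zero]
  obtain ⟨R, hR, hHR, hevR⟩ := exists_ball_of_analyticAt hH (hev.and hP.eventually_analyticAt)
  have hball := Metric.ball_mem_nhds a hR
  obtain ⟨z, hz⟩ := (hH0.and_eventually hball).exists
  obtain ⟨b, hb, k, hk, hk0, hkFG⟩ := mem_closure_iff_nhds.1 ha _ hball
  have hbn : Metric.ball a R ∈ 𝓝 b := Metric.isOpen_ball.mem_nhds hb
  have hkH := frequently_mul_ne_zero hk (hHR b hb) hk0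
    (frequently_ne_zero_of_ball hHR hz.2 hz.1 hb)
  have hPR : AnalyticOnNhd ℂ P (Metric.ball a R) := fun s hs => (hevR s hs).2
  -- Near the point `b` of generic equality `P` vanishes off a thin set, hence identically; the
  -- identity theorem then spreads this over the ball.
  have hPb : P =ᶠ[𝓝 b] 0 := by
    by_contra hcon
    have hPf : ∃ᶠ s in 𝓝 b, P s ≠ 0 := fun h => hcon (h.mono fun s hs => not_not.1 hs)
    obtain ⟨s, hs, hs1, hs2⟩ := ((frequently_mul_ne_zero (hk.mul (hHR b hb)) (hPR b hb)
      hkH hPf).and_eventually (hkFG.and hbn)).exists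
    have h1 := left_ne_zero_of_mul hs
    exact right_ne_zero_of_mul hs (((hevR s hs2).1 (right_ne_zero_of_mul h1)).1
      (hs1 (left_ne_zero_of_mul h1)))
  have hP0 := hPR.eqOn_zero_of_preconnected_of_eventuallyEq_zero
    (convex_ball a R).isPreconnected hb hPb
  refine ⟨H, hH, hH0, ?_⟩
  filter_upwards [hball] with s hs hsH
  exact ((hevR s hs).1 hsH).2 (hP0 hs)

/-- Identity theorem for meromorphic functions on `ℂ^d`. -/
theorem IsMeromorphic.genericEqAt {d : ℕ} {F G : (Fin d → ℂ) → ℂ} (hF : IsMeromorphic F)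
    (hG : IsMeromorphic G) {a : Fin d → ℂ} (ha : ∀ᶠ s in 𝓝 a, F s = G s) (b : Fin d → ℂ) :
    GenericEqAt F G b := by
  have hclopen : IsClopen {a | GenericEqAt F G a} :=
    ⟨isClosed_of_closure_subset fun a ha => genericEqAt_of_mem_closure hF hG ha,
      isOpen_setOf_genericEqAt F G⟩
  have hne : {a | GenericEqAt F G a}.Nonempty :=
    ⟨a, fun _ => 1, analyticAt_const, Filter.Frequently.of_forall fun _ => one_ne_zero,
      ha.mono fun s hs _ => hs⟩
  have := hclopen.eq_univ hne
  exact this.ge (Set.mem_univ b)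

/-! ### Meromorphic functions that can be restricted to a slice -/

section FractionAlong

set_option linter.unusedSectionVars false

variable {E D : Type*} [NormedAddCommGroup E] [NormedSpace ℂ E]
  [NormedAddCommGroup D] [NormedSpace ℂ D]

/-- Near `ι y₀`, the function `F` is a quotient of holomorphic functions whose denominator does not
vanish identically along `ι` near `y₀`. -/
def FractionAlong (F : E → ℂ) (ι : D → E) (y₀ : D) : Prop :=
  ∃ f g : E → ℂ, AnalyticAt ℂ f (ι y₀) ∧ AnalyticAt ℂ g (ι y₀) ∧ (∃ᶠ y in 𝓝 y₀, g (ι y) ≠ 0) ∧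
    ∀ᶠ s in 𝓝 (ι y₀), g s ≠ 0 → F s = f s / g s

theorem AnalyticAt.fractionAlong {F : E → ℂ} {ι : D → E} {y₀ : D} (hF : AnalyticAt ℂ F (ι y₀)) :
    FractionAlong F ι y₀ :=
  ⟨F, fun _ => 1, hF, analyticAt_const, Filter.Frequently.of_forall fun _ => one_ne_zero,
    Filter.Eventually.of_forall fun _ _ => (div_one _).symm⟩

theorem fractionAlong_inv {g : E → ℂ} {ι : D → E} {y₀ : D} (hg : AnalyticAt ℂ g (ι y₀))
    (hg0 : ∃ᶠ y in 𝓝 y₀, g (ι y) ≠ 0) : FractionAlong (fun s => (g s)⁻¹) ι y₀ :=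
  ⟨fun _ => 1, g, analyticAt_const, hg, hg0,
    Filter.Eventually.of_forall fun _ _ => (one_div _).symm⟩

theorem FractionAlong.congr {F G : E → ℂ} {ι : D → E} {y₀ : D} (hG : FractionAlong G ι y₀)
    (h : ∀ᶠ s in 𝓝 (ι y₀), F s = G s) : FractionAlong F ι y₀ := by
  obtain ⟨f, g, hf, hg, hg0, hGe⟩ := hG
  refine ⟨f, g, hf, hg, hg0, ?_⟩
  filter_upwards [h, hGe] with s h1 h2 h3
  rw [h1, h2 h3]

theorem FractionAlong.mul {F G : E → ℂ} {ι : D → E} {y₀ : D} (hι : AnalyticAt ℂ ι y₀)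
    (hF : FractionAlong F ι y₀) (hG : FractionAlong G ι y₀) :
    FractionAlong (fun s => F s * G s) ι y₀ := by
  obtain ⟨f, g, hf, hg, hg0, hFe⟩ := hF
  obtain ⟨f', g', hf', hg', hg0', hGe⟩ := hG
  refine ⟨fun s => f s * f' s, fun s => g s * g' s, hf.mul hf', hg.mul hg',
    frequently_mul_ne_zero (hg.comp hι) (hg'.comp hι) hg0 hg0', ?_⟩
  filter_upwards [hFe, hGe] with s h1 h2 h3
  rw [h1 (left_ne_zero_of_mul h3), h2 (right_ne_zero_of_mul h3), div_mul_div_comm]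

theorem FractionAlong.add {F G : E → ℂ} {ι : D → E} {y₀ : D} (hι : AnalyticAt ℂ ι y₀)
    (hF : FractionAlong F ι y₀) (hG : FractionAlong G ι y₀) :
    FractionAlong (fun s => F s + G s) ι y₀ := by
  obtain ⟨f, g, hf, hg, hg0, hFe⟩ := hF
  obtain ⟨f', g', hf', hg', hg0', hGe⟩ := hG
  refine ⟨fun s => f s * g' s + g s * f' s, fun s => g s * g' s,
    (hf.mul hg').add (hg.mul hf'), hg.mul hg',
    frequently_mul_ne_zero (hg.comp hι) (hg'.comp hι) hg0 hg0', ?_⟩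
  filter_upwards [hFe, hGe] with s h1 h2 h3
  rw [h1 (left_ne_zero_of_mul h3), h2 (right_ne_zero_of_mul h3),
    div_add_div _ _ (left_ne_zero_of_mul h3) (right_ne_zero_of_mul h3)]

theorem FractionAlong.sum {κ : Type*} {F : κ → E → ℂ} {ι : D → E} {y₀ : D}
    (hι : AnalyticAt ℂ ι y₀) (t : Finset κ) (hF : ∀ i ∈ t, FractionAlong (F i) ι y₀) :
    FractionAlong (fun s => ∑ i ∈ t, F i s) ι y₀ := by
  classical
  induction t using Finset.induction_on with
  | empty =>
    simp only [Finset.sum_empty]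
    exact AnalyticAt.fractionAlong analyticAt_const
  | insert i t hi ih =>
    simp only [Finset.sum_insert hi]
    exact (hF i (Finset.mem_insert_self i t)).add hι
      (ih fun j hj => hF j (Finset.mem_insert_of_mem hj))

/-- Pulling back by `ψ` could make the denominator vanish along the new slice. The map `κ` excludes
this: it embeds the old slice into the new one compatibly with `ψ`, so nonvanishing points are
carried over. -/
theorem FractionAlong.comp {E' D' : Type*} [NormedAddCommGroup E'] [NormedSpace ℂ E']
    [NormedAddCommGroup D'] [NormedSpace ℂ D'] {F : E → ℂ} {ι : D → E} {y₀ : D}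
    (hF : FractionAlong F ι y₀) {ψ : E' → E} {ι' : D' → E'} {κ : D → D'} (hκ : ContinuousAt κ y₀)
    (hψ : AnalyticAt ℂ ψ (ι' (κ y₀))) (hcomp : ∀ y, ψ (ι' (κ y)) = ι y) :
    FractionAlong (fun s => F (ψ s)) ι' (κ y₀) := by
  obtain ⟨f, g, hf, hg, hg0, hFe⟩ := hF
  rw [← hcomp] at hf hg hFe
  refine ⟨fun s => f (ψ s), fun s => g (ψ s), hf.comp hψ, hg.comp hψ, ?_,
    hψ.continuousAt.eventually hFe⟩
  exact hκ.tendsto.frequently (p := fun y => g (ψ (ι' y)) ≠ 0) (by simpa only [hcomp] using hg0)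

theorem FractionAlong.isFractionAt {d : ℕ} {F : (Fin d → ℂ) → ℂ} {ι : D → Fin d → ℂ} {y₀ : D}
    (hι : ContinuousAt ι y₀) (hF : FractionAlong F ι y₀) : ∃ f g, IsFractionAt F f g (ι y₀) := by
  obtain ⟨f, g, hf, hg, hg0, hFe⟩ := hF
  exact ⟨f, g, hf, hg, hι.tendsto.frequently hg0, fun _ => 1, analyticAt_const,
    Filter.Frequently.of_forall fun _ => one_ne_zero, hFe.mono fun s hs _ => hs⟩

end FractionAlong

/-! ### The binomial series -/

/-- The coefficient `s (s + 1) ⋯ (s + m - 1) / m!` of `x^m` in `(1 - x)^{-s}`. -/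
noncomputable def risingCoeff (m : ℕ) (s : ℂ) : ℂ := (∏ i ∈ Finset.range m, (s + i)) / m.factorial

theorem risingCoeff_eq_choose (m : ℕ) (s : ℂ) : risingCoeff m s = Ring.choose (s + m - 1) m := by
  have h1 : ((ascPochhammer ℕ m).smeval s) = ∏ i ∈ Finset.range m, (s + i) := by
    rw [Polynomial.ascPochhammer_smeval_eq_eval]
    induction m with
    | zero => simp
    | succ m ih => rw [ascPochhammer_succ_eval, Finset.prod_range_succ, ih]
  have h2 := Ring.factorial_nsmul_multichoose_eq_ascPochhammer s m
  rw [h1, nsmul_eq_mul] at h2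
  have h3 : (m.factorial : ℂ) ≠ 0 := by exact_mod_cast m.factorial_ne_zero
  rw [risingCoeff, ← h2, mul_div_cancel_left₀ _ h3, Ring.choose]
  congr 1
  ring

theorem hasSum_risingCoeff (s : ℂ) {x : ℂ} (hx : ‖x‖ < 1) :
    HasSum (fun m => risingCoeff m s * x ^ m) ((1 - x) ^ (-s)) := by
  have h := (Complex.one_div_one_sub_cpow_hasFPowerSeriesOnBall_zero s).hasSum (y := x)
    (by simpa [enorm_eq_nnnorm, ← NNReal.coe_lt_coe] using hx)
  rw [zero_add, one_div, ← Complex.cpow_neg] at h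
  refine h.congr_fun fun m => ?_
  rw [FormalMultilinearSeries.ofScalars_apply_eq, risingCoeff_eq_choose, smul_eq_mul]

theorem norm_risingCoeff_le (m : ℕ) {s : ℂ} {B : ℝ} (hs : ‖s‖ ≤ B) :
    ‖risingCoeff m s‖ ≤ ‖risingCoeff m (B : ℂ)‖ := by
  have hB : 0 ≤ B := (norm_nonneg s).trans hs
  unfold risingCoeff
  rw [norm_div, norm_div, norm_prod, norm_prod]
  gcongr with i
  calc ‖s + i‖ ≤ ‖s‖ + ‖(i : ℂ)‖ := norm_add_le _ _
    _ ≤ B + i := by rw [Complex.norm_natCast]; linarith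
    _ = ‖(B + i : ℂ)‖ := by
      rw [← Complex.ofReal_natCast, ← Complex.ofReal_add, Complex.norm_real, Real.norm_of_nonneg]
      positivity

theorem summable_norm_risingCoeff (s : ℂ) {x : ℝ} (hx0 : 0 ≤ x) (hx : x < 1) :
    Summable fun m => ‖risingCoeff m s‖ * x ^ m := by
  have h := (hasSum_risingCoeff s (x := (x : ℂ))
    (by rwa [Complex.norm_real, Real.norm_of_nonneg hx0])).summable.norm
  refine h.congr fun m => ?_
  rw [norm_mul, norm_pow, Complex.norm_real, Real.norm_of_nonneg hx0]

theorem analyticAt_risingCoeff (m : ℕ) (s : ℂ) : AnalyticAt ℂ (risingCoeff m) s := by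
  have : Differentiable ℂ (risingCoeff m) := by
    unfold risingCoeff
    fun_prop
  exact this.analyticAt s

/-! ### The function `q_0`: bounds and zeros -/

section QFun

variable {q : ℝ} (hq0 : 0 < q) (hq1 : q < 1)
include hq0

theorem norm_cpow_of_base_pos (z : ℂ) : ‖(q : ℂ) ^ z‖ = q ^ z.re :=
  Complex.norm_cpow_eq_rpow_re_of_pos hq0 z

theorem differentiable_cpow_base : Differentiable ℂ fun z : ℂ => (q : ℂ) ^ z := by
  have : (q : ℂ) ≠ 0 := by exact_mod_cast hq0.ne'
  exact fun z => (differentiableAt_id).const_cpow (Or.inl this)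

theorem differentiable_qFun : Differentiable ℂ (qFun q 0) := by
  have h := (differentiable_cpow_base hq0).comp (differentiable_id.neg)
  have : qFun q 0 = fun z => ((fun z : ℂ => (q : ℂ) ^ z) ∘ (-id)) z - 1 := by
    funext z; simp [qFun]
  rw [this]
  exact h.sub_const 1

theorem analyticAt_qFun (z : ℂ) : AnalyticAt ℂ (qFun q 0) z :=
  (differentiable_qFun hq0).analyticAt z

include hq1

/-- By the reverse triangle inequality `|q^{-z} - 1| ≥ q^{-Re z} - 1 ≥ (1 - q^δ) q^{-Re z}`. -/
theorem norm_inv_qFun_le {δ : ℝ} (hδ : 0 < δ) {z : ℂ} (hz : δ ≤ z.re) :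
    ‖(qFun q 0 z)⁻¹‖ ≤ q ^ z.re / (1 - q ^ δ) := by
  have hδ1 : q ^ δ < 1 := Real.rpow_lt_one hq0.le hq1 hδ
  have h1 : q ^ z.re ≤ q ^ δ := Real.rpow_le_rpow_of_exponent_ge hq0 hq1.le hz
  have h2 : 0 < q ^ z.re := Real.rpow_pos_of_pos hq0 _
  have h3 : (q ^ z.re)⁻¹ - 1 ≤ ‖qFun q 0 z‖ := by
    have := norm_sub_norm_le ((q : ℂ) ^ (-(z + (0 : ℕ)))) 1
    rw [norm_cpow_of_base_pos hq0, norm_one] at this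
    simpa [qFun, Real.rpow_neg hq0.le] using this
  have h4 : 0 < (1 - q ^ δ) / q ^ z.re := div_pos (by linarith) h2
  have h5 : (1 - q ^ δ) / q ^ z.re ≤ ‖qFun q 0 z‖ := by
    refine le_trans ?_ h3
    rw [div_le_iff₀ h2, sub_mul, inv_mul_cancel₀ h2.ne']
    linarith
  rw [norm_inv, ← inv_div]
  exact inv_anti₀ h4 h5

theorem qFun_ne_zero {z : ℂ} (hz : z.re ≠ 0) : qFun q 0 z ≠ 0 := by
  intro h
  have h1 : (q : ℂ) ^ (-z) = 1 := by simpa [qFun, sub_eq_zero] using h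
  have h2 := norm_cpow_of_base_pos hq0 (-z)
  rw [h1, norm_one, Complex.neg_re] at h2
  rcases lt_or_gt_of_ne hz with h3 | h3
  · exact absurd h2 (Real.rpow_lt_one hq0.le hq1 (by linarith)).ne'
  · exact absurd h2 (Real.one_lt_rpow_of_pos_of_lt_one_of_neg hq0 hq1 (by linarith)).ne

theorem frequently_qFun_ne_zero (z : ℂ) : ∃ᶠ w in 𝓝 z, qFun q 0 w ≠ 0 := by
  refine frequently_ne_zero_of_ball (a := 1) (R := ‖z - 1‖ + 1) (x := 1)
    (fun w _ => analyticAt_qFun hq0 w) (Metric.mem_ball_self (by positivity))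
    (qFun_ne_zero hq0 hq1 (by simp)) ?_
  rw [mem_ball_iff_norm]
  linarith

end QFun

/-! ### Shifted domains of convergence -/

section Region

/-- The tail `(s₂, …, s_{r+1})` of `s`. -/
def tailVec {r : ℕ} (s : Fin (r + 1) → ℂ) : Fin r → ℂ := fun i => s i.succ

/-- The shifted region `Re (c + s₁ + ⋯ + s_j) > δ` for all `j`. -/
def Region (δ : ℝ) (r : ℕ) (c : ℂ) (s : Fin r → ℂ) : Prop :=
  ∀ j : Fin r, δ < (c + ∑ i ∈ Finset.Iic j, s i).re

theorem sum_Iic_succ {r : ℕ} (s : Fin (r + 1) → ℂ) (j : Fin r) :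
    ∑ i ∈ Finset.Iic j.succ, s i = s 0 + ∑ i ∈ Finset.Iic j, tailVec s i := by
  have h : ∀ {n : ℕ} (j : Fin n), Finset.Iic j = Finset.univ.filter (· ≤ j) := fun j => by
    ext; simp
  rw [h, h, Finset.sum_filter, Finset.sum_filter, Fin.sum_univ_succ]
  simp [tailVec]

theorem region_succ {δ : ℝ} {r : ℕ} {c : ℂ} {s : Fin (r + 1) → ℂ} :
    Region δ (r + 1) c s ↔ δ < (c + s 0).re ∧ Region δ r (c + s 0) (tailVec s) := by
  have h0 : Finset.Iic (0 : Fin (r + 1)) = {0} := by ext; simp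
  unfold Region
  rw [Fin.forall_fin_succ, h0, Finset.sum_singleton]
  simp only [sum_Iic_succ, add_assoc]

theorem Region.mono {δ : ℝ} {r : ℕ} {c c' : ℂ} {s : Fin r → ℂ} (h : Region δ r c s)
    (hc : c.re ≤ c'.re) : Region δ r c' s := fun j => by
  have := h j
  rw [Complex.add_re] at this ⊢
  linarith

theorem isOpen_region (δ : ℝ) (r : ℕ) (a : ℂ) :
    IsOpen {p : ℂ × (Fin r → ℂ) | Region δ r (p.1 + a) p.2} := by
  simp only [Region, Set.ofPred_forall]
  refine isOpen_iInter_of_finite fun j => isOpen_lt continuous_const ?_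
  fun_prop

theorem exists_region (δ : ℝ) (r : ℕ) (c : ℂ) (s : Fin r → ℂ) : ∃ N₀ : ℕ, ∀ N ≥ N₀, Region δ r (c + (N : ℂ)) s := by
  have h : ∀ j : Fin r, ∀ᶠ N : ℕ in atTop, δ < (c + (N : ℂ) + ∑ i ∈ Finset.Iic j, s i).re := by
    intro j
    filter_upwards [(tendsto_natCast_atTop_atTop (R := ℝ)).eventually_gt_atTop
      (δ - (c + ∑ i ∈ Finset.Iic j, s i).re)] with N hN
    simp only [Complex.add_re, Complex.natCast_re] at hN ⊢
    linarith
  exact eventually_atTop.1 (eventually_all.2 h)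

end Region

/-! ### Meromorphic continuation by the shifted recursion -/

section Continuation

/-- The continuation of `∑_{k₁ > ⋯ > k_r ≥ 1} q^{k₁ c} ∏ q^{k_i s_i} (1 - q^{k_i})^{-s_i}`. -/
noncomputable def shiftedZeta (q : ℝ) : (r : ℕ) → ℂ → (Fin r → ℂ) → ℂ
  | 0, _, _ => 1
  | r + 1, c, s => ∑' m : ℕ, risingCoeff m (s 0) * (qFun q 0 (c + s 0 + m))⁻¹ *
      shiftedZeta q r (c + s 0 + m) (tailVec s)

/-- The terms of the series defining `shiftedZeta`. -/
noncomputable def shiftedTerm (q : ℝ) (r m : ℕ) (c : ℂ) (s : Fin (r + 1) → ℂ) : ℂ :=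
  risingCoeff m (s 0) * (qFun q 0 (c + s 0 + m))⁻¹ * shiftedZeta q r (c + s 0 + m) (tailVec s)

theorem shiftedZeta_succ (q : ℝ) (r : ℕ) (c : ℂ) (s : Fin (r + 1) → ℂ) :
    shiftedZeta q (r + 1) c s = ∑' m, shiftedTerm q r m c s := rfl

variable {q : ℝ} (hq0 : 0 < q) (hq1 : q < 1)
include hq0 hq1

/-- The `N` skipped terms move the shift into the region where the depth `r` factor is bounded by
`C`. The decay `q ^ m` comes from `1 / q_0`, and the binomial coefficient is largest at the real
point `B`. -/
theorem norm_shiftedTerm_le {δ B C : ℝ} (hδ : 0 < δ) {r : ℕ}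
    (hC : ∀ c s, Region δ r c s → (∀ i, ‖s i‖ ≤ B) → ‖shiftedZeta q r c s‖ ≤ C)
    (N m : ℕ) {c : ℂ} {s : Fin (r + 1) → ℂ} (h : Region δ (r + 1) (c + N) s)
    (hs : ∀ i, ‖s i‖ ≤ B) :
    ‖shiftedTerm q r (m + N) c s‖ ≤
      ‖risingCoeff (m + N) (B : ℂ)‖ * q ^ m * (C / (1 - q ^ δ)) := by
  have hδ1 : 0 < 1 - q ^ δ := sub_pos.2 (Real.rpow_lt_one hq0.le hq1 hδ)
  obtain ⟨h1, h2⟩ := region_succ.1 h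
  have hre : δ + m < (c + s 0 + (m + N : ℕ)).re := by
    simp only [Complex.add_re, Complex.natCast_re, Nat.cast_add] at h1 ⊢
    linarith
  have h3 : ‖shiftedZeta q r (c + s 0 + (m + N : ℕ)) (tailVec s)‖ ≤ C := by
    refine hC _ _ (h2.mono ?_) fun i => hs _
    simp only [Complex.add_re, Complex.natCast_re, Nat.cast_add]
    linarith [(Nat.cast_nonneg m : (0 : ℝ) ≤ m)]
  have h4 : ‖(qFun q 0 (c + s 0 + (m + N : ℕ)))⁻¹‖ ≤ q ^ m / (1 - q ^ δ) := by
    refine (norm_inv_qFun_le hq0 hq1 hδ (by linarith [(Nat.cast_nonneg m : (0 : ℝ) ≤ m)])).trans ?_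
    gcongr
    rw [← Real.rpow_natCast]
    exact Real.rpow_le_rpow_of_exponent_ge hq0 hq1.le (by linarith)
  unfold shiftedTerm
  rw [norm_mul, norm_mul]
  calc _ ≤ ‖risingCoeff (m + N) (B : ℂ)‖ * (q ^ m / (1 - q ^ δ)) * C := by
        gcongr
        exact norm_risingCoeff_le _ (hs 0)
    _ = _ := by ring

theorem summable_shiftedTerm_bound (B K : ℝ) (N : ℕ) :
    Summable fun m => ‖risingCoeff (m + N) (B : ℂ)‖ * q ^ m * K := by
  have h := ((summable_nat_add_iff N).2 (summable_norm_risingCoeff (B : ℂ) hq0.le hq1)).mul_right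
    ((q ^ N)⁻¹)
  refine (h.congr fun m => ?_).mul_right K
  rw [pow_add]
  field_simp

theorem exists_norm_shiftedZeta_le {δ : ℝ} (hδ : 0 < δ) (B : ℝ) (r : ℕ) :
    ∃ C, 0 ≤ C ∧ ∀ c s, Region δ r c s → (∀ i, ‖s i‖ ≤ B) → ‖shiftedZeta q r c s‖ ≤ C := by
  induction r with
  | zero => exact ⟨1, zero_le_one, fun c s _ _ => by simp [shiftedZeta]⟩
  | succ r ih =>
    obtain ⟨C, hC0, hC⟩ := ih
    have hδ1 : 0 < 1 - q ^ δ := sub_pos.2 (Real.rpow_lt_one hq0.le hq1 hδ)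
    have hs := summable_shiftedTerm_bound hq0 hq1 B (C / (1 - q ^ δ)) 0
    refine ⟨∑' m, ‖risingCoeff (m + 0) (B : ℂ)‖ * q ^ m * (C / (1 - q ^ δ)),
      tsum_nonneg fun m => by positivity, fun c s hR hB => ?_⟩
    · rw [shiftedZeta_succ]
      exact tsum_of_norm_bounded hs.hasSum fun m =>
        norm_shiftedTerm_le hq0 hq1 hδ hC 0 m (by simpa using hR) hB

theorem summable_shiftedTerm {δ : ℝ} (hδ : 0 < δ) {r N : ℕ} {c : ℂ} {s : Fin (r + 1) → ℂ}
    (h : Region δ (r + 1) (c + N) s) : Summable fun m => shiftedTerm q r m c s := by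
  obtain ⟨C, hC0, hC⟩ := exists_norm_shiftedZeta_le hq0 hq1 hδ ‖s‖ r
  rw [← summable_nat_add_iff N]
  exact Summable.of_norm_bounded (summable_shiftedTerm_bound hq0 hq1 ‖s‖ (C / (1 - q ^ δ)) N)
    fun m => norm_shiftedTerm_le hq0 hq1 hδ hC N m h fun i => norm_le_pi_norm s i

omit hq0 hq1 in
theorem analyticAt_coord_zero (r : ℕ) (p : ℂ × (Fin (r + 1) → ℂ)) :
    AnalyticAt ℂ (fun p : ℂ × (Fin (r + 1) → ℂ) => p.2 0) p :=
  ((ContinuousLinearMap.proj (R := ℂ) (φ := fun _ : Fin (r + 1) => ℂ) 0).comp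
    (ContinuousLinearMap.snd ℂ ℂ (Fin (r + 1) → ℂ))).analyticAt p

omit hq0 hq1 in
theorem analyticAt_shift (r m : ℕ) (p : ℂ × (Fin (r + 1) → ℂ)) :
    AnalyticAt ℂ (fun p : ℂ × (Fin (r + 1) → ℂ) => p.1 + p.2 0 + (m : ℂ)) p :=
  (analyticAt_fst.add (analyticAt_coord_zero r p)).add analyticAt_const

omit hq0 hq1 in
theorem analyticAt_tailVec (r : ℕ) (s : Fin (r + 1) → ℂ) : AnalyticAt ℂ (tailVec (r := r)) s :=
  (ContinuousLinearMap.pi fun i : Fin r =>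
    (ContinuousLinearMap.proj (R := ℂ) (φ := fun _ : Fin (r + 1) => ℂ) i.succ)).analyticAt s

omit hq0 hq1 in
theorem analyticAt_shift_tailVec (r m : ℕ) (p : ℂ × (Fin (r + 1) → ℂ)) :
    AnalyticAt ℂ (fun p : ℂ × (Fin (r + 1) → ℂ) => (p.1 + p.2 0 + (m : ℂ), tailVec p.2)) p :=
  (analyticAt_shift r m p).prod ((analyticAt_tailVec r p.2).comp analyticAt_snd)

omit hq0 hq1 in
theorem analyticAt_risingCoeff_snd (r m : ℕ) (p : ℂ × (Fin (r + 1) → ℂ)) :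
    AnalyticAt ℂ (fun p : ℂ × (Fin (r + 1) → ℂ) => risingCoeff m (p.2 0)) p :=
  (analyticAt_risingCoeff m (p.2 0)).comp (f := fun p : ℂ × (Fin (r + 1) → ℂ) => p.2 0)
    (analyticAt_coord_zero r p)

theorem analyticAt_tail_of_analyticAt {δ : ℝ} (hδ : 0 < δ) {r : ℕ}
    (hW : ∀ c s, Region δ r c s →
      AnalyticAt ℂ (fun p : ℂ × (Fin r → ℂ) => shiftedZeta q r p.1 p.2) (c, s))
    {N : ℕ} {c : ℂ} {s : Fin (r + 1) → ℂ} (h : Region δ (r + 1) (c + N) s) :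
    AnalyticAt ℂ (fun p : ℂ × (Fin (r + 1) → ℂ) => ∑' m, shiftedTerm q r (m + N) p.1 p.2)
      (c, s) := by
  obtain ⟨R, hR, hsub⟩ := Metric.isOpen_iff.1 (isOpen_region δ (r + 1) (N : ℂ)) (c, s) h
  obtain ⟨C, hC0, hC⟩ := exists_norm_shiftedZeta_le hq0 hq1 hδ (‖s‖ + R) r
  refine normalSumsAnalytic_of_finiteDimensional (ℂ × (Fin (r + 1) → ℂ)) ℂ ℕ
    (fun m p => shiftedTerm q r (m + N) p.1 p.2) _ (c, s) R hR (fun m p hp => ?_)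
    (fun m p hp => norm_shiftedTerm_le hq0 hq1 hδ hC N m (hsub hp) fun i => ?_)
    (summable_shiftedTerm_bound hq0 hq1 (‖s‖ + R) (C / (1 - q ^ δ)) N)
  · obtain ⟨h1, h2⟩ := region_succ.1 (hsub hp)
    have hre : (p.1 + N + p.2 0).re ≤ (p.1 + p.2 0 + (m + N : ℕ)).re := by
      simp only [Complex.add_re, Complex.natCast_re, Nat.cast_add]
      linarith [(Nat.cast_nonneg m : (0 : ℝ) ≤ m)]
    refine ((analyticAt_risingCoeff_snd r (m + N) p).mul ?_).mul ?_
    · exact ((analyticAt_qFun hq0 _).comp (analyticAt_shift r (m + N) p)).inv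
        (qFun_ne_zero hq0 hq1 (ne_of_gt (by linarith)))
    · exact AnalyticAt.comp (g := fun p : ℂ × (Fin r → ℂ) => shiftedZeta q r p.1 p.2)
        (f := fun p : ℂ × (Fin (r + 1) → ℂ) => (p.1 + p.2 0 + ((m + N : ℕ) : ℂ), tailVec p.2))
        (hW _ _ (h2.mono hre)) (analyticAt_shift_tailVec r (m + N) p)
  · have h1 : ‖p.2 - s‖ < R := by
      rw [← ball_prod_same] at hp
      exact mem_ball_iff_norm.1 hp.2
    have h2 := norm_le_pi_norm p.2 i
    have h3 := norm_le_norm_add_norm_sub' p.2 s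
    linarith

theorem analyticAt_shiftedZeta {δ : ℝ} (hδ : 0 < δ) (r : ℕ) : ∀ (c : ℂ) (s : Fin r → ℂ),
    Region δ r c s → AnalyticAt ℂ (fun p : ℂ × (Fin r → ℂ) => shiftedZeta q r p.1 p.2) (c, s) := by
  induction r with
  | zero => exact fun _ _ _ => analyticAt_const
  | succ r ih =>
    intro c s h
    exact analyticAt_tail_of_analyticAt hq0 hq1 hδ ih (N := 0) (by simpa using h)

theorem analyticAt_tail {δ : ℝ} (hδ : 0 < δ) {r N : ℕ} {c : ℂ} {s : Fin (r + 1) → ℂ}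
    (h : Region δ (r + 1) (c + N) s) :
    AnalyticAt ℂ (fun p : ℂ × (Fin (r + 1) → ℂ) => ∑' m, shiftedTerm q r (m + N) p.1 p.2)
      (c, s) :=
  analyticAt_tail_of_analyticAt hq0 hq1 hδ (analyticAt_shiftedZeta hq0 hq1 hδ r) h

theorem eventually_shiftedZeta_eq {r N : ℕ} {c : ℂ} {s : Fin (r + 1) → ℂ}
    (h : Region 1 (r + 1) (c + N) s) : ∀ᶠ p : ℂ × (Fin (r + 1) → ℂ) in 𝓝 (c, s),
      shiftedZeta q (r + 1) p.1 p.2 = (∑ m ∈ Finset.range N, shiftedTerm q r m p.1 p.2) +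
        ∑' m, shiftedTerm q r (m + N) p.1 p.2 := by
  filter_upwards [(isOpen_region 1 (r + 1) (N : ℂ)).mem_nhds h] with p hp
  rw [shiftedZeta_succ]
  exact ((summable_shiftedTerm hq0 hq1 one_pos hp).sum_add_tsum_nat_add N).symm

/-- The slices fix `c` because the final use sets `c` to a constant: `0` for the zeta function, `m -
n` in the `m`-th term on `s₁ = -n`. Joint meromorphy in `(c, s)` would not ensure that the
denominator survives these restrictions. -/
theorem fractionAlong_shiftedZeta (r : ℕ) : ∀ (c : ℂ) (s : Fin r → ℂ),
    FractionAlong (fun p : ℂ × (Fin r → ℂ) => shiftedZeta q r p.1 p.2) (fun y => (c, y)) s := by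
  induction r with
  | zero => exact fun _ _ => AnalyticAt.fractionAlong analyticAt_const
  | succ r ih =>
    intro c s
    have hι : ∀ y, AnalyticAt ℂ (fun y : Fin (r + 1) → ℂ => (c, y)) y := fun y =>
      analyticAt_const.prod analyticAt_id
    obtain ⟨N, hN⟩ := exists_region 1 (r + 1) c s
    refine FractionAlong.congr ?_ (eventually_shiftedZeta_eq hq0 hq1 (hN N le_rfl))
    refine (FractionAlong.sum (hι s) _ fun m _ => ?_).add (hι s)
      (AnalyticAt.fractionAlong (analyticAt_tail hq0 hq1 one_pos (hN N le_rfl)))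
    have hs : Fin.cons (s 0) (tailVec s) = s := Fin.cons_self_tail s
    have hs' : Fin.cons (c + s 0 + m - c - m) (tailVec s) = s := by
      rw [show c + s 0 + m - c - m = s 0 by ring, hs]
    refine ((AnalyticAt.fractionAlong (analyticAt_risingCoeff_snd r m (c, s))).mul (hι s) ?_).mul
      (hι s) ?_
    · have h1 : FractionAlong (fun z => (qFun q 0 z)⁻¹) (fun z : ℂ => z) (c + s 0 + m) :=
        fractionAlong_inv (analyticAt_qFun hq0 _) (frequently_qFun_ne_zero hq0 hq1 _)
      -- With `c` and the tail fixed, `κ` varies the first coordinate so that `c + s₁ + m` runs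
      -- through a full neighbourhood in `ℂ`.
      have h2 := h1.comp (ψ := fun p : ℂ × (Fin (r + 1) → ℂ) => p.1 + p.2 0 + (m : ℂ))
        (ι' := fun y => (c, y)) (κ := fun z => (Fin.cons (z - c - m) (tailVec s)))
        (Continuous.continuousAt (continuous_pi fun i => by
          refine Fin.cases ?_ (fun i => ?_) i <;> simp <;> fun_prop))
        (analyticAt_shift r m _) (fun z => by simp only [Fin.cons_zero]; ring)
      rwa [hs'] at h2
    · have h2 := (ih (c + s 0 + m) (tailVec s)).comp
        (ψ := fun p : ℂ × (Fin (r + 1) → ℂ) => (p.1 + p.2 0 + (m : ℂ), tailVec p.2))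
        (ι' := fun y => (c, y)) (κ := fun y => (Fin.cons (s 0) y))
        (Continuous.continuousAt (continuous_pi fun i => by
          refine Fin.cases ?_ (fun i => ?_) i <;> simp <;> fun_prop))
        (analyticAt_shift_tailVec r m _) (fun z => by simp; rfl)
      rwa [hs] at h2

end Continuation

/-! ### Removing the largest index -/

section IndexSets

/-- The largest entry `k₁` of an index, `0` in depth `0`. -/
def Index.top {r : ℕ} (k : Index r) : ℕ := Finset.univ.sup k.1

theorem Index.le_top {r : ℕ} (k : Index r) (i : Fin r) : k.1 i ≤ k.top :=
  Finset.le_sup (f := k.1) (Finset.mem_univ i)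

/-- Prepending an entry larger than all entries of an index. -/
def Index.cons {r : ℕ} (k : Index r) (j : ℕ) : Index (r + 1) :=
  ⟨Fin.cons (k.top + 1 + j) k.1, by
    constructor
    · intro a b hab
      rcases Fin.eq_zero_or_eq_succ b with rfl | ⟨b, rfl⟩
      · exact absurd hab (Fin.not_lt_zero a)
      · rcases Fin.eq_zero_or_eq_succ a with rfl | ⟨a, rfl⟩
        · have := k.le_top b
          simp only [Fin.cons_succ, Fin.cons_zero]
          omega
        · simpa using k.2.1 (Fin.succ_lt_succ_iff.1 hab)
    · intro i
      rcases Fin.eq_zero_or_eq_succ i with rfl | ⟨i, rfl⟩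
      · simp only [Fin.cons_zero]; omega
      · simpa using k.2.2 i⟩

theorem Index.top_eq {r : ℕ} (k : Index (r + 1)) : k.top = k.1 0 :=
  le_antisymm (Finset.sup_le fun i _ => k.2.1.antitone (Fin.zero_le i)) (k.le_top 0)

theorem Index.cons_bijective (r : ℕ) :
    Function.Bijective fun p : Index r × ℕ => p.1.cons p.2 := by
  constructor
  · rintro ⟨k, j⟩ ⟨k', j'⟩ h
    have h1 : (Fin.cons (k.top + 1 + j) k.1 : Fin (r + 1) → ℕ) =
      Fin.cons (k'.top + 1 + j') k'.1 := congrArg Subtype.val h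
    obtain ⟨h2, h3⟩ := Fin.cons_injective2 h1
    have h4 : k = k' := Subtype.ext h3
    subst h4
    have : j = j' := by omega
    rw [this]
  · intro k
    let k' : Index r := ⟨fun i => k.1 i.succ,
      fun a b hab => k.2.1 (Fin.succ_lt_succ_iff.2 hab), fun i => k.2.2 _⟩
    have htop : k'.top < k.1 0 := by
      refine (Finset.sup_lt_iff (k.2.2 0)).2 fun i _ => k.2.1 (Fin.succ_pos i)
    refine ⟨⟨k', k.1 0 - (k'.top + 1)⟩, Subtype.ext ?_⟩
    funext i
    rcases Fin.eq_zero_or_eq_succ i with rfl | ⟨i, rfl⟩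
    · simp only [Index.cons, Fin.cons_zero]; omega
    · simp [Index.cons, k']

end IndexSets

/-! ### Identification of the continuation with the series -/

section Series

/-- The factor `q^{ks} (1 - q^k)^{-s}`. -/
noncomputable def powFactor (q : ℝ) (k : ℕ) (s : ℂ) : ℂ :=
  (q : ℂ) ^ ((k : ℂ) * s) * ((1 - q ^ k : ℝ) : ℂ) ^ (-s)

/-- The term `q^{k₁ c} ∏ q^{k_i s_i} (1 - q^{k_i})^{-s_i}`. -/
noncomputable def shiftedSeriesTerm (q : ℝ) {r : ℕ} (c : ℂ) (s : Fin r → ℂ) (k : Index r) : ℂ :=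
  (q : ℂ) ^ ((k.top : ℂ) * c) * ∏ i, powFactor q (k.1 i) (s i)

theorem ofReal_cpow_re {b : ℝ} (hb : 0 < b) (z : ℂ) : (b : ℂ) ^ (z.re : ℂ) = (‖(b : ℂ) ^ z‖ : ℝ) := by
  rw [Complex.norm_cpow_eq_rpow_re_of_pos hb, Complex.ofReal_cpow hb.le]

variable {q : ℝ} (hq0 : 0 < q) (hq1 : q < 1)
include hq0 hq1

theorem powFactor_re {k : ℕ} (hk : 1 ≤ k) (s : ℂ) :
    powFactor q k (s.re : ℂ) = (‖powFactor q k s‖ : ℝ) := by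
  have h1 : 0 < 1 - q ^ k := sub_pos.2 (pow_lt_one₀ hq0.le hq1 (by omega))
  have h2 : (k : ℂ) * (s.re : ℂ) = (((k : ℂ) * s).re : ℂ) := by simp
  have h3 : -(s.re : ℂ) = ((-s).re : ℂ) := by simp
  rw [powFactor, powFactor, norm_mul, Complex.ofReal_mul, h2, h3, ofReal_cpow_re hq0,
    ofReal_cpow_re h1]

theorem shiftedSeriesTerm_re {r : ℕ} (c : ℂ) (s : Fin r → ℂ) (k : Index r) :
    shiftedSeriesTerm q (c.re : ℂ) (fun i => ((s i).re : ℂ)) k =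
      (‖shiftedSeriesTerm q c s k‖ : ℝ) := by
  have h2 : (k.top : ℂ) * (c.re : ℂ) = (((k.top : ℂ) * c).re : ℂ) := by simp
  rw [shiftedSeriesTerm, shiftedSeriesTerm, norm_mul, norm_prod, Complex.ofReal_mul,
    Complex.ofReal_prod, h2, ofReal_cpow_re hq0]
  congr 1
  exact Finset.prod_congr rfl fun i _ => powFactor_re hq0 hq1 (k.2.2 i) (s i)

omit hq0 hq1 in
theorem region_re {δ : ℝ} {r : ℕ} {c : ℂ} {s : Fin r → ℂ} (h : Region δ r c s) :
    Region δ r (c.re : ℂ) (fun i => ((s i).re : ℂ)) := fun j => by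
  simpa using h j

theorem norm_cpow_lt_one {z : ℂ} (hz : 0 < z.re) : ‖(q : ℂ) ^ z‖ < 1 := by
  rw [norm_cpow_of_base_pos hq0]
  exact Real.rpow_lt_one hq0.le hq1 hz

theorem hasSum_geometric_qFun {z : ℂ} (hz : 0 < z.re) :
    HasSum (fun j : ℕ => ((q : ℂ) ^ z) ^ (j + 1)) (qFun q 0 z)⁻¹ := by
  have hq : (q : ℂ) ≠ 0 := by exact_mod_cast hq0.ne'
  have h1 : (q : ℂ) ^ z ≠ 0 := by simp [Complex.cpow_eq_zero_iff, hq]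
  have h2 := (hasSum_geometric_of_norm_lt_one (norm_cpow_lt_one hq0 hq1 hz)).mul_left ((q : ℂ) ^ z)
  have h3 : (qFun q 0 z)⁻¹ = (q : ℂ) ^ z * (1 - (q : ℂ) ^ z)⁻¹ := by
    rw [qFun, Nat.cast_zero, add_zero, Complex.cpow_neg, ← div_eq_mul_inv, ← inv_div, sub_div,
      one_div, div_self h1]
  rw [h3]
  refine h2.congr_fun fun j => ?_
  rw [pow_succ']

/-- With `z = c + s₁ + m` and top entry `K = k.top + 1 + j`, the power `q^{Kz}` splits into
`q^{k.top z}`, the shift in lower depth, and `(q^z)^{j+1}`, a term of a geometric series. -/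
theorem shiftedSeriesTerm_cons {r : ℕ} (c : ℂ) (s : Fin (r + 1) → ℂ) (k : Index r) (j : ℕ) :
    HasSum (fun m : ℕ => risingCoeff m (s 0) * (shiftedSeriesTerm q (c + s 0 + m) (tailVec s) k *
      ((q : ℂ) ^ (c + s 0 + m)) ^ (j + 1))) (shiftedSeriesTerm q c s (k.cons j)) := by
  have hq : (q : ℂ) ≠ 0 := by exact_mod_cast hq0.ne'
  set K := k.top + 1 + j with hK
  have hx : ‖(q : ℂ) ^ K‖ < 1 := by
    rw [norm_pow, Complex.norm_real, Real.norm_of_nonneg hq0.le]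
    exact pow_lt_one₀ hq0.le hq1 (by omega)
  have h := (hasSum_risingCoeff (s 0) hx).mul_left
    ((q : ℂ) ^ ((K : ℂ) * (c + s 0)) * ∏ i, powFactor q (k.1 i) (tailVec s i))
  have hval : shiftedSeriesTerm q c s (k.cons j) =
      (q : ℂ) ^ ((K : ℂ) * (c + s 0)) * (∏ i, powFactor q (k.1 i) (tailVec s i)) *
        (1 - (q : ℂ) ^ K) ^ (-s 0) := by
    rw [shiftedSeriesTerm, Index.top_eq, Fin.prod_univ_succ]
    simp only [Index.cons, Fin.cons_zero, Fin.cons_succ, powFactor, tailVec, ← hK]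
    rw [mul_add, Complex.cpow_add _ _ hq]
    push_cast
    ring
  rw [hval]
  refine h.congr_fun fun m => ?_
  have e1 : ((q : ℂ) ^ (c + s 0 + m)) ^ (j + 1) = (q : ℂ) ^ (((j + 1 : ℕ) : ℂ) * (c + s 0 + m)) := by
    rw [Complex.cpow_nat_mul]
  have e2 : ((q : ℂ) ^ K) ^ m = (q : ℂ) ^ ((K : ℂ) * (m : ℂ)) := by
    rw [← pow_mul, ← Nat.cast_mul, Complex.cpow_natCast]
  have e3 : (q : ℂ) ^ ((k.top : ℂ) * (c + s 0 + m)) * (q : ℂ) ^ (((j + 1 : ℕ) : ℂ) * (c + s 0 + m)) =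
      (q : ℂ) ^ ((K : ℂ) * (c + s 0)) * (q : ℂ) ^ ((K : ℂ) * (m : ℂ)) := by
    rw [← Complex.cpow_add _ _ hq, ← Complex.cpow_add _ _ hq]
    congr 1
    rw [hK]; push_cast; ring
  rw [e1, e2, shiftedSeriesTerm]
  linear_combination (risingCoeff m (s 0) * ∏ i, powFactor q (k.1 i) (tailVec s i)) * e3

/-- The norm of a term is the same term at the real parts of the parameters, so the sum of norms is
itself a value of `shiftedZeta`. This makes the uniform bound on `shiftedZeta` control absolute
convergence. -/
theorem tsum_norm_shiftedSeriesTerm_le {r : ℕ} {c : ℂ} {s : Fin r → ℂ} {C : ℝ}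
    (h : HasSum (shiftedSeriesTerm q (c.re : ℂ) fun i => ((s i).re : ℂ))
      (shiftedZeta q r (c.re : ℂ) fun i => ((s i).re : ℂ)))
    (hC : ‖shiftedZeta q r (c.re : ℂ) fun i => ((s i).re : ℂ)‖ ≤ C) :
    ∑' k, ‖shiftedSeriesTerm q c s k‖ ≤ C := by
  have h1 : (fun k => shiftedSeriesTerm q (c.re : ℂ) (fun i => ((s i).re : ℂ)) k) =
      fun k => ((‖shiftedSeriesTerm q c s k‖ : ℝ) : ℂ) :=
    funext fun k => shiftedSeriesTerm_re hq0 hq1 c s k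
  have h2 := h.tsum_eq
  rw [h1, ← Complex.ofReal_tsum] at h2
  rw [← h2, Complex.norm_real] at hC
  exact (Real.le_norm_self _).trans hC

theorem hasSum_shiftedSeriesTerm {δ : ℝ} (hδ : 0 < δ) (r : ℕ) : ∀ (c : ℂ) (s : Fin r → ℂ),
    Region δ r c s → HasSum (shiftedSeriesTerm q c s) (shiftedZeta q r c s) := by
  induction r with
  | zero =>
    intro c s _
    have hu : ∀ k : Index 0, k = ⟨Fin.elim0, fun a => a.elim0, fun i => i.elim0⟩ := fun k =>
      Subtype.ext (funext fun i => i.elim0)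
    have : Unique (Index 0) := ⟨⟨_⟩, hu⟩
    have h := hasSum_unique (shiftedSeriesTerm q c s)
    convert h using 1
    simp [shiftedSeriesTerm, shiftedZeta, Index.top]
  | succ r ih =>
    intro c s hR
    obtain ⟨C, hC0, hC⟩ := exists_norm_shiftedZeta_le hq0 hq1 hδ ‖s‖ r
    obtain ⟨hre, hR'⟩ := region_succ.1 hR
    have hδ1 : 0 < 1 - q ^ δ := sub_pos.2 (Real.rpow_lt_one hq0.le hq1 hδ)
    let z : ℕ → ℂ := fun m => c + s 0 + m
    have hzre : ∀ m, δ + m < (z m).re := fun m => by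
      simp only [z, Complex.add_re, Complex.natCast_re] at hre ⊢
      linarith
    have hzδ : ∀ m, δ < (z m).re := fun m => by
      linarith [hzre m, (Nat.cast_nonneg m : (0 : ℝ) ≤ m)]
    have hzR : ∀ m, Region δ r (z m) (tailVec s) := fun m => hR'.mono (by
      simp only [z, Complex.add_re, Complex.natCast_re]
      linarith [(Nat.cast_nonneg m : (0 : ℝ) ≤ m)])
    -- The common refinement: summing over `(k, j)` first gives the terms of the recursion, summing
    -- over `m` first gives the terms of the series. Absolute summability permits the exchange.
    let T : ℕ × (Index r × ℕ) → ℂ := fun p => risingCoeff p.1 (s 0) *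
      (shiftedSeriesTerm q (z p.1) (tailVec s) p.2.1 * ((q : ℂ) ^ z p.1) ^ (p.2.2 + 1))
    have hsA : ∀ m, Summable fun k => ‖shiftedSeriesTerm q (z m) (tailVec s) k‖ := fun m =>
      (ih _ _ (hzR m)).summable.norm
    have hgeo := fun m => hasSum_geometric_qFun hq0 hq1 (hδ.trans (hzδ m))
    have hsB : ∀ m, Summable fun j : ℕ => ‖((q : ℂ) ^ z m) ^ (j + 1)‖ := fun m =>
      (hgeo m).summable.norm
    have hTm : ∀ m, HasSum (fun p => T (m, p)) (shiftedTerm q r m c s) := fun m => by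
      have h0 : Summable fun p : Index r × ℕ => shiftedSeriesTerm q (z m) (tailVec s) p.1 *
          ((q : ℂ) ^ z m) ^ (p.2 + 1) :=
        summable_mul_of_summable_norm (f := fun k => shiftedSeriesTerm q (z m) (tailVec s) k)
          (g := fun j : ℕ => ((q : ℂ) ^ z m) ^ (j + 1)) (hsA m) (hsB m)
      have h1 := (HasSum.mul (ih _ _ (hzR m)) (hgeo m) h0).mul_left (risingCoeff m (s 0))
      have h2 : shiftedTerm q r m c s = risingCoeff m (s 0) *
          (shiftedZeta q r (z m) (tailVec s) * (qFun q 0 (z m))⁻¹) := by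
        rw [shiftedTerm]
        ring
      rw [h2]
      exact h1
    have hTs : Summable T := by
      refine Summable.of_norm ((summable_prod_of_nonneg fun p => norm_nonneg _).2
        ⟨fun m => (hTm m).summable.norm, ?_⟩)
      refine Summable.of_nonneg_of_le (fun m => tsum_nonneg fun p => norm_nonneg _) (fun m => ?_)
        (summable_shiftedTerm_bound hq0 hq1 ‖s‖ (C / (1 - q ^ δ)) 0)
      have h1 : ∑' p, ‖T (m, p)‖ = ‖risingCoeff m (s 0)‖ *
          ((∑' k, ‖shiftedSeriesTerm q (z m) (tailVec s) k‖) *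
            ∑' j : ℕ, ‖((q : ℂ) ^ z m) ^ (j + 1)‖) := by
        rw [tsum_mul_tsum_of_summable_norm (by simpa using hsA m) (by simpa using hsB m),
          ← tsum_mul_left]
        simp only [T, norm_mul]
      have h2 : ∑' k, ‖shiftedSeriesTerm q (z m) (tailVec s) k‖ ≤ C := by
        refine tsum_norm_shiftedSeriesTerm_le hq0 hq1 (ih _ _ (region_re (hzR m)))
          (hC _ _ (region_re (hzR m)) fun i => ?_)
        rw [Complex.norm_real]
        exact (Complex.abs_re_le_norm _).trans (norm_le_pi_norm s i.succ)
      have h3 : ∑' j : ℕ, ‖((q : ℂ) ^ z m) ^ (j + 1)‖ ≤ q ^ m / (1 - q ^ δ) := by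
        have hn := norm_cpow_lt_one hq0 hq1 (hδ.trans (hzδ m))
        simp only [pow_succ, norm_mul, norm_pow]
        rw [tsum_mul_right, tsum_geometric_of_lt_one (norm_nonneg _) hn, inv_mul_eq_div,
          norm_cpow_of_base_pos hq0]
        have h4 : q ^ (z m).re ≤ q ^ δ :=
          Real.rpow_le_rpow_of_exponent_ge hq0 hq1.le (hzδ m).le
        have h5 : q ^ (z m).re ≤ q ^ m := by
          rw [← Real.rpow_natCast]
          exact Real.rpow_le_rpow_of_exponent_ge hq0 hq1.le (by linarith [hzre m])
        gcongr
      have h6 : 0 ≤ ∑' j : ℕ, ‖((q : ℂ) ^ z m) ^ (j + 1)‖ := tsum_nonneg fun j => norm_nonneg _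
      have h7 := norm_risingCoeff_le m (norm_le_pi_norm s 0)
      have h8 := mul_le_mul h7 (mul_le_mul h2 h3 h6 hC0)
        (mul_nonneg (tsum_nonneg fun k => norm_nonneg _) h6) (norm_nonneg _)
      rw [h1]
      refine h8.trans_eq ?_
      rw [add_zero]
      ring
    have hT : HasSum T (shiftedZeta q (r + 1) c s) := by
      have h1 := (hTs.hasSum.prod_fiberwise hTm).tsum_eq
      rw [shiftedZeta_succ, h1]
      exact hTs.hasSum
    have hT' : HasSum (fun p : (Index r × ℕ) × ℕ => T (p.2, p.1)) (shiftedZeta q (r + 1) c s) :=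
      ((Equiv.prodComm (Index r × ℕ) ℕ).hasSum_iff).2 hT
    have h0 : ∀ p : Index r × ℕ, HasSum (fun m => T (m, p))
        (shiftedSeriesTerm q c s (p.1.cons p.2)) := fun p =>
      shiftedSeriesTerm_cons hq0 hq1 c s p.1 p.2
    have h1 : HasSum (fun p : Index r × ℕ => shiftedSeriesTerm q c s (p.1.cons p.2))
        (shiftedZeta q (r + 1) c s) := HasSum.prod_fiberwise hT' h0
    exact (Equiv.hasSum_iff (Equiv.ofBijective _ (Index.cons_bijective r))).1 h1

end Series

/-! ### Restoring the powers of `1 - q` -/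

section Zeta

/-- The meromorphic continuation of the `q`-multiple zeta series. -/
noncomputable def qZeta (q : ℝ) (r : ℕ) (s : Fin r → ℂ) : ℂ :=
  (∏ i, ((1 - q : ℝ) : ℂ) ^ s i) * shiftedZeta q r 0 s

variable {q : ℝ} (hq0 : 0 < q) (hq1 : q < 1)
include hq0 hq1

theorem term_eq {r : ℕ} (s : Fin r → ℂ) (k : Index r) :
    term q s k = (∏ i, ((1 - q : ℝ) : ℂ) ^ s i) * shiftedSeriesTerm q 0 s k := by
  have hq : (q : ℂ) ≠ 0 := by exact_mod_cast hq0.ne'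
  have h1 : (q : ℂ) ^ (∑ i, (k.1 i : ℂ) * s i) = ∏ i, (q : ℂ) ^ ((k.1 i : ℂ) * s i) := by
    simp only [Complex.cpow_def_of_ne_zero hq]
    rw [Finset.mul_sum, Complex.exp_sum]
  rw [term, shiftedSeriesTerm, h1, mul_zero, Complex.cpow_zero, one_mul, ← Finset.prod_div_distrib,
    ← Finset.prod_mul_distrib]
  refine Finset.prod_congr rfl fun i _ => ?_
  have h2 : 0 < 1 - q := sub_pos.2 hq1
  have h3 : 0 < 1 - q ^ k.1 i := sub_pos.2 (pow_lt_one₀ hq0.le hq1 (by have := k.2.2 i; omega))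
  have h4 : ((1 - q ^ k.1 i : ℝ) : ℂ) ^ s i = (qInt q (k.1 i) : ℂ) ^ s i * ((1 - q : ℝ) : ℂ) ^ s i := by
    rw [qInt, ← Complex.mul_cpow_ofReal_nonneg (div_pos h3 h2).le h2.le, ← Complex.ofReal_mul,
      div_mul_cancel₀ _ h2.ne']
  have h5 : (qInt q (k.1 i) : ℂ) ^ s i ≠ 0 := by
    have : (qInt q (k.1 i) : ℂ) ≠ 0 := by exact_mod_cast (div_pos h3 h2).ne'
    simp [Complex.cpow_eq_zero_iff, this]
  have h6 : ((1 - q : ℝ) : ℂ) ^ s i ≠ 0 := by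
    have : ((1 - q : ℝ) : ℂ) ≠ 0 := by exact_mod_cast h2.ne'
    rw [Ne, Complex.cpow_eq_zero_iff]
    tauto
  rw [powFactor, Complex.cpow_neg, h4]
  field_simp

theorem hasSum_qZeta {r : ℕ} {s : Fin r → ℂ} (hs : s ∈ domainU r) :
    HasSum (term q s) (qZeta q r s) := by
  -- Finitely many strict inequalities leave room for a common margin `δ`.
  obtain ⟨δ, hδ, hR⟩ : ∃ δ > 0, Region δ r 0 s := by
    have h : ∀ j : Fin r, ∀ᶠ δ in 𝓝[>] (0 : ℝ), δ < (0 + ∑ i ∈ Finset.Iic j, s i).re := fun j =>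
      (eventually_lt_nhds (by simpa using hs j)).filter_mono nhdsWithin_le_nhds
    obtain ⟨δ, h1, h2⟩ := ((eventually_all.2 h).and self_mem_nhdsWithin).exists
    exact ⟨δ, h2, h1⟩
  have h := (hasSum_shiftedSeriesTerm hq0 hq1 hδ r 0 s hR).mul_left
    (∏ i, ((1 - q : ℝ) : ℂ) ^ s i)
  exact h.congr_fun fun k => term_eq hq0 hq1 s k

end Zeta

theorem risingCoeff_neg_natCast (n : ℕ) : risingCoeff n (-(n : ℂ)) = (-1) ^ n := by
  have h : ∏ i ∈ Finset.range n, (-(n : ℂ) + i) = (-1) ^ n * (n.factorial : ℂ) := by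
    rw [← Finset.prod_range_add_one_eq_factorial, ← Finset.prod_range_reflect]
    have hsign : ((-1 : ℂ)) ^ n = ∏ _i ∈ Finset.range n, (-1 : ℂ) := by simp
    push_cast
    rw [hsign, ← Finset.prod_mul_distrib]
    refine Finset.prod_congr rfl fun i hi => ?_
    have : ((n - 1 - i : ℕ) : ℂ) = n - 1 - i := by
      have hi' := Finset.mem_range.1 hi
      rw [Nat.cast_sub (by omega), Nat.cast_sub (by omega), Nat.cast_one]
    rw [this]
    ring
  have h3 : (n.factorial : ℂ) ≠ 0 := by exact_mod_cast n.factorial_ne_zero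
  rw [risingCoeff, h, mul_div_cancel_right₀ _ h3]

/-! ### The residue along `s₁ = -n` -/

section Residue

variable {q : ℝ} (hq0 : 0 < q) (hq1 : q < 1)
include hq0

theorem hasDerivAt_qFun_zero : HasDerivAt (qFun q 0) (-(Real.log q : ℂ)) 0 := by
  have hq : (q : ℂ) ≠ 0 := by exact_mod_cast hq0.ne'
  have h1 := ((hasDerivAt_neg (0 : ℂ)).const_cpow (c := (q : ℂ)) (Or.inl hq)).sub_const 1
  have h2 : qFun q 0 = fun z => (q : ℂ) ^ (-z) - 1 := by
    funext z; simp [qFun]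
  rw [h2]
  rw [Complex.ofReal_log hq0.le]
  exact h1.congr_deriv (by simp)

/-- The quotient `q_0(z) / z`, continued to `z = 0`. -/
theorem exists_qFun_eq_mul : ∃ v : ℂ → ℂ, AnalyticAt ℂ v 0 ∧ v 0 = -(Real.log q : ℂ) ∧
    ∀ z, qFun q 0 z = z * v z := by
  refine ⟨dslope (qFun q 0) 0, ?_, ?_, fun z => ?_⟩
  · exact (((Complex.differentiableOn_dslope univ_mem).2
      (differentiable_qFun hq0).differentiableOn).analyticAt univ_mem)
  · rw [dslope_same, (hasDerivAt_qFun_zero hq0).deriv]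
  · have h := sub_smul_dslope (qFun q 0) 0 z
    have h0 : qFun q 0 0 = 0 := by simp [qFun]
    rw [h0, sub_zero, sub_zero, smul_eq_mul] at h
    exact h.symm

include hq1

omit hq0 in
theorem analyticAt_prod_cpow {r : ℕ} (s : Fin r → ℂ) :
    AnalyticAt ℂ (fun s : Fin r → ℂ => ∏ i, ((1 - q : ℝ) : ℂ) ^ s i) s :=
  Finset.univ.analyticAt_fun_prod fun i _ =>
    ((differentiable_cpow_base (sub_pos.2 hq1)).analyticAt (s i)).comp
      (f := fun s : Fin r → ℂ => s i)
      ((ContinuousLinearMap.proj (R := ℂ) (φ := fun _ : Fin r => ℂ) i).analyticAt s)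

theorem isMeromorphic_qZeta (r : ℕ) : IsMeromorphic (qZeta q r) := by
  intro s
  have h1 := (fractionAlong_shiftedZeta hq0 hq1 r 0 s).comp
    (ψ := fun s : Fin r → ℂ => ((0 : ℂ), s)) (ι' := fun s => s) (κ := fun s => s)
    continuousAt_id (analyticAt_const.prod analyticAt_id) fun y => rfl
  have h2 : FractionAlong (qZeta q r) (fun s => s) s :=
    (AnalyticAt.fractionAlong (ι := fun s => s) (analyticAt_prod_cpow hq1 s)).mul
      analyticAt_id h1
  exact h2.isFractionAt continuousAt_id

theorem isQMultiZeta_qZeta (r : ℕ) : IsQMultiZeta q r (qZeta q r) :=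
  ⟨isMeromorphic_qZeta hq0 hq1 r, fun _ hs => hasSum_qZeta hq0 hq1 hs⟩

/-- Both functions sum the same series on the nonempty open set `domainU r`, so the identity theorem
applies from the point `(1, …, 1)`. -/
theorem IsQMultiZeta.genericEqAt {r : ℕ} {Z : (Fin r → ℂ) → ℂ} (hZ : IsQMultiZeta q r Z)
    (a : Fin r → ℂ) : GenericEqAt Z (qZeta q r) a := by
  have hopen : IsOpen (domainU r) := by
    simp only [domainU, Set.ofPred_forall]
    refine isOpen_iInter_of_finite fun j => isOpen_lt continuous_const ?_
    fun_prop
  have hone : (fun _ => 1 : Fin r → ℂ) ∈ domainU r := fun j => by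
    simp only [Finset.sum_const, nsmul_eq_mul, mul_one, Complex.natCast_re, Nat.cast_pos]
    exact Finset.card_pos.2 ⟨j, Finset.mem_Iic.2 le_rfl⟩
  refine hZ.meromorphic.genericEqAt (isMeromorphic_qZeta hq0 hq1 r) (a := fun _ => 1) ?_ a
  filter_upwards [hopen.mem_nhds hone] with s hs
  exact (hZ.hasSum s hs).unique (hasSum_qZeta hq0 hq1 hs)

omit hq0 hq1 in
theorem analyticAt_vecCons {r : ℕ} (c : ℂ) (b : Fin r → ℂ) :
    AnalyticAt ℂ (fun y : Fin r → ℂ => (Matrix.vecCons c y : Fin (r + 1) → ℂ)) b :=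
  AnalyticAt.comp (g := Fin.consEquivL ℂ fun _ : Fin (r + 1) => ℂ)
    (f := fun y : Fin r → ℂ => (c, y))
    ((Fin.consEquivL ℂ fun _ : Fin (r + 1) => ℂ).toContinuousLinearMap.analyticAt _)
    (analyticAt_const.prod analyticAt_id)

/-- A representative of `(s₁ + n) ζ_q` near the hyperplane `s₁ = -n` on which its restriction to the
hyperplane is computed termwise. -/
theorem exists_residue_representative (r n : ℕ) (b : Fin r → ℂ) :
    ∃ H : (Fin (r + 1) → ℂ) → ℂ,
      FractionAlong H (fun y : Fin r → ℂ => (Matrix.vecCons (-(n : ℂ)) y : Fin (r + 1) → ℂ)) b ∧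
      (∀ᶠ s in 𝓝 (Matrix.vecCons (-(n : ℂ)) b : Fin (r + 1) → ℂ),
        s 0 + (n : ℂ) ≠ 0 → (s 0 + (n : ℂ)) * qZeta q (r + 1) s = H s) ∧
      ∀ y : Fin r → ℂ, H (Matrix.vecCons (-(n : ℂ)) y) =
        ((1 - q : ℝ) : ℂ) ^ (-(n : ℂ)) * (-1) ^ n * (-(Real.log q : ℂ))⁻¹ * qZeta q r y := by
  classical
  obtain ⟨v, hv, hv0, hqv⟩ := exists_qFun_eq_mul hq0
  set a : Fin (r + 1) → ℂ := Matrix.vecCons (-(n : ℂ)) b with ha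
  let ι : (Fin r → ℂ) → (Fin (r + 1) → ℂ) := fun y => Matrix.vecCons (-(n : ℂ)) y
  have hι : AnalyticAt ℂ ι b := analyticAt_vecCons _ b
  have hlog : (-(Real.log q : ℂ)) ≠ 0 := by
    rw [neg_ne_zero]
    exact_mod_cast (Real.log_neg hq0 hq1).ne
  -- Taking `N > n` keeps the singular term `m = n` in the finite part, away from the holomorphic
  -- tail.
  obtain ⟨N, hnN, hN⟩ : ∃ N : ℕ, n < N ∧ Region 1 (r + 1) (0 + (N : ℂ)) a := by
    obtain ⟨N₀, h⟩ := exists_region 1 (r + 1) 0 a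
    exact ⟨max N₀ (n + 1), by omega, h _ (le_max_left _ _)⟩
  have hzero : ∀ s : Fin (r + 1) → ℂ,
      AnalyticAt ℂ (fun s : Fin (r + 1) → ℂ => ((0 : ℂ), s)) s := fun s =>
    analyticAt_const.prod analyticAt_id
  have hcoord : AnalyticAt ℂ (fun s : Fin (r + 1) → ℂ => s 0 + n) a :=
    ((ContinuousLinearMap.proj (R := ℂ) (φ := fun _ : Fin (r + 1) => ℂ) 0).analyticAt a).add
      analyticAt_const
  have htail : AnalyticAt ℂ (fun s : Fin (r + 1) → ℂ => ∑' m, shiftedTerm q r (m + N) 0 s) a :=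
    AnalyticAt.comp
      (g := fun p : ℂ × (Fin (r + 1) → ℂ) => ∑' m, shiftedTerm q r (m + N) p.1 p.2)
      (f := fun s : Fin (r + 1) → ℂ => ((0 : ℂ), s))
      (analyticAt_tail hq0 hq1 one_pos hN) (hzero a)
  have hrise : ∀ m, AnalyticAt ℂ (fun s : Fin (r + 1) → ℂ => risingCoeff m (s 0)) a := fun m =>
    (analyticAt_risingCoeff_snd r m (0, a)).comp (hzero a)
  have hshift : ∀ m : ℕ, AnalyticAt ℂ (fun s : Fin (r + 1) → ℂ => 0 + s 0 + (m : ℂ)) a := fun m =>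
    (analyticAt_shift r m (0, a)).comp (hzero a)
  have hW : ∀ m : ℕ, FractionAlong
      (fun s : Fin (r + 1) → ℂ => shiftedZeta q r (0 + s 0 + m) (tailVec s)) ι b := fun m =>
    (fractionAlong_shiftedZeta hq0 hq1 r (0 + -(n : ℂ) + m) b).comp (κ := fun y => y)
      (ψ := fun s : Fin (r + 1) → ℂ => (0 + s 0 + (m : ℂ), tailVec s)) continuousAt_id
      ((analyticAt_shift_tailVec r m (0, a)).comp (hzero a)) fun y => rfl
  let A : (Fin (r + 1) → ℂ) → ℂ := fun s => ∏ i, ((1 - q : ℝ) : ℂ) ^ s i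
  -- In the term `m = n` the factor `s₁ + n` is cancelled against `q_0(s₁ + n) = (s₁ + n) v(s₁ +
  -- n)`; all other terms keep it and drop out on the hyperplane.
  let H : (Fin (r + 1) → ℂ) → ℂ := fun s => A s * ((s 0 + n) *
    (∑ m ∈ (Finset.range N).erase n, shiftedTerm q r m 0 s +
      ∑' m, shiftedTerm q r (m + N) 0 s) +
    risingCoeff n (s 0) * (v (s 0 + n))⁻¹ * shiftedZeta q r (0 + s 0 + n) (tailVec s))
  refine ⟨H, ?_, ?_, ?_⟩
  · have hA : FractionAlong A ι b := AnalyticAt.fractionAlong (analyticAt_prod_cpow hq1 a)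
    refine hA.mul hι (FractionAlong.add hι (FractionAlong.mul hι
      (AnalyticAt.fractionAlong hcoord) (FractionAlong.add hι
        (FractionAlong.sum hι _ fun m hm => ?_) (AnalyticAt.fractionAlong htail))) ?_)
    · refine FractionAlong.mul hι (AnalyticAt.fractionAlong ((hrise m).mul ?_)) (hW m)
      refine ((analyticAt_qFun hq0 _).comp (hshift m)).inv (qFun_ne_zero hq0 hq1 ?_)
      have hmn : (m : ℝ) ≠ n := by exact_mod_cast Finset.ne_of_mem_erase hm
      have : (0 + a 0 + (m : ℂ)).re = m - n := by
        simp only [ha, Matrix.cons_val_zero, Complex.add_re, Complex.zero_re, Complex.neg_re,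
          Complex.natCast_re]
        ring
      rw [this, sub_ne_zero]
      exact hmn
    · refine FractionAlong.mul hι (AnalyticAt.fractionAlong ((hrise n).mul ?_)) (hW n)
      have ha0 : a 0 + n = 0 := by simp [ha]
      refine AnalyticAt.inv (f := fun s : Fin (r + 1) → ℂ => v (s 0 + n)) ?_ ?_
      · exact AnalyticAt.comp (g := v) (f := fun s : Fin (r + 1) → ℂ => s 0 + n)
          (by rwa [ha0]) hcoord
      · change v (a 0 + n) ≠ 0
        rw [ha0, hv0]
        exact hlog
  · have hev := (hzero a).continuousAt.eventually (eventually_shiftedZeta_eq hq0 hq1 hN)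
    filter_upwards [hev] with s hs hsn
    simp only [H, qZeta, hs]
    rw [← Finset.add_sum_erase _ _ (Finset.mem_range.2 hnN)]
    have h1 : shiftedTerm q r n 0 s = risingCoeff n (s 0) * ((s 0 + n) * v (s 0 + n))⁻¹ *
        shiftedZeta q r (0 + s 0 + n) (tailVec s) := by
      rw [shiftedTerm, ← hqv, zero_add]
    have h2 : (s 0 + n) * shiftedTerm q r n 0 s = risingCoeff n (s 0) * (v (s 0 + n))⁻¹ *
        shiftedZeta q r (0 + s 0 + n) (tailVec s) := by
      rw [h1, mul_inv]
      field_simp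
    rw [← h2]
    ring
  · intro y
    have h0 : (Matrix.vecCons (-(n : ℂ)) y : Fin (r + 1) → ℂ) 0 = -(n : ℂ) := rfl
    have h1 : tailVec (Matrix.vecCons (-(n : ℂ)) y : Fin (r + 1) → ℂ) = y := rfl
    simp only [H, A, h0, h1, qZeta, zero_add, neg_add_cancel, zero_mul, hv0,
      risingCoeff_neg_natCast]
    rw [Fin.prod_univ_succ]
    simp only [Matrix.cons_val_zero, Matrix.cons_val_succ]
    ring

theorem residue_constant (n : ℕ) (w : ℂ) :
    -((n.factorial : ℂ) * calL q (n + 1) (-(n : ℂ)) * w) / (Real.log q : ℂ) =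
      ((1 - q : ℝ) : ℂ) ^ (-(n : ℂ)) * (-1) ^ n * (-(Real.log q : ℂ))⁻¹ * w := by
  rw [calL_succ_eq, factorial_mul_compositionSum q hq0 hq1, Complex.cpow_neg, Complex.cpow_natCast,
    div_pow, inv_neg]
  push_cast
  ring

theorem isResidueAlong {r : ℕ} (n : ℕ) {Z : (Fin (r + 1) → ℂ) → ℂ} {Z' : (Fin r → ℂ) → ℂ}
    (hZ : IsQMultiZeta q (r + 1) Z) (hZ' : IsQMultiZeta q r Z') :
    IsResidueAlong Z (-(n : ℂ)) (fun y =>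
      -((n.factorial : ℂ) * calL q (n + 1) (-(n : ℂ)) * Z' y) / (Real.log q : ℂ)) := by
  intro b
  obtain ⟨H, ⟨f, g, hf, hg, hg0, hH⟩, hHZ, hHy⟩ := exists_residue_representative hq0 hq1 r n b
  have hι := analyticAt_vecCons (-(n : ℂ)) b
  have hone : ∀ {d : ℕ} (a : Fin d → ℂ), ∃ᶠ s in 𝓝 a, (1 : ℂ) ≠ 0 := fun a =>
    Filter.Frequently.of_forall fun _ => one_ne_zero
  refine ⟨f, g, ?_, ?_⟩
  · have hfr : IsFractionAt H f g (Matrix.vecCons (-(n : ℂ)) b) :=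
      ⟨hf, hg, hι.continuousAt.tendsto.frequently hg0, fun _ => 1, analyticAt_const, hone _,
        hH.mono fun s hs _ => hs⟩
    refine hfr.congr ?_
    obtain ⟨h, hh, hh0, hZe⟩ := hZ.genericEqAt hq0 hq1 (Matrix.vecCons (-(n : ℂ)) b)
    have hc : AnalyticAt ℂ (fun s : Fin (r + 1) → ℂ => s 0 + n) (Matrix.vecCons (-(n : ℂ)) b) :=
      ((ContinuousLinearMap.proj (R := ℂ) (φ := fun _ : Fin (r + 1) => ℂ) 0).analyticAt _).add
        analyticAt_const
    have hc0 : ∃ᶠ s in 𝓝 (Matrix.vecCons (-(n : ℂ)) b : Fin (r + 1) → ℂ), s 0 + (n : ℂ) ≠ 0 := by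
      refine frequently_ne_zero_of_ball (a := Matrix.vecCons (-(n : ℂ)) b)
        (h := fun s : Fin (r + 1) → ℂ => s 0 + n) (R := 2)
        (x := (Matrix.vecCons (-(n : ℂ)) b) + fun _ => 1)
        (fun s _ => ((ContinuousLinearMap.proj (R := ℂ) (φ := fun _ : Fin (r + 1) => ℂ)
          0).analyticAt s).add analyticAt_const) ?_ ?_ (Metric.mem_ball_self two_pos)
      · rw [mem_ball_iff_norm, add_sub_cancel_left]
        exact (pi_norm_const_le (1 : ℂ)).trans_lt (by rw [norm_one]; norm_num)
      · simp
    -- The exceptional set is enlarged by the hyperplane itself, where `H` need not agree with the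
    -- product `(s₁ + n) Z`.
    refine ⟨fun s => h s * (s 0 + (n : ℂ)), hh.mul hc, frequently_mul_ne_zero hh hc hh0 hc0, ?_⟩
    filter_upwards [hZe, hHZ] with s h1 h2 h3
    rw [h1 (left_ne_zero_of_mul h3), sub_neg_eq_add, h2 (right_ne_zero_of_mul h3)]
  · have hfr : IsFractionAt (fun y : Fin r → ℂ => H (Matrix.vecCons (-(n : ℂ)) y))
        (fun y => f (Matrix.vecCons (-(n : ℂ)) y)) (fun y => g (Matrix.vecCons (-(n : ℂ)) y)) b :=
      ⟨hf.comp hι, hg.comp hι, hg0, fun _ => 1, analyticAt_const, hone _,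
        (hι.continuousAt.eventually hH).mono fun s hs _ => hs⟩
    refine hfr.congr ?_
    obtain ⟨h, hh, hh0, hZe⟩ := hZ'.genericEqAt hq0 hq1 b
    refine ⟨h, hh, hh0, hZe.mono fun y hy hy0 => ?_⟩
    simp only
    rw [hHy, hy hy0, residue_constant hq0 hq1]

end Residue

end QMZV

theorem mainTheorem4 (q : ℝ) (hq0 : 0 < q) (hq1 : q < 1) :
    (∀ (n : ℕ) (t : ℂ), 1 ≤ n → (∀ i < n - 1, QMZV.qFun q i t ≠ 0) →
      QMZV.detD q n t = (∏ l ∈ Finset.range (n - 1), (t + l)) * QMZV.calL q n t) ∧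
    (∀ r : ℕ, ∃ Z : (Fin r → ℂ) → ℂ, QMZV.IsQMultiZeta q r Z) ∧
    (∀ (r n : ℕ) (Z : (Fin (r + 1) → ℂ) → ℂ) (Z' : (Fin r → ℂ) → ℂ),
      QMZV.IsQMultiZeta q (r + 1) Z → QMZV.IsQMultiZeta q r Z' →
        QMZV.IsResidueAlong Z (-(n : ℂ))
          (fun y => -((n.factorial : ℂ) * QMZV.calL q (n + 1) (-(n : ℂ)) * Z' y) /
            (Real.log q : ℂ))) := by
  refine ⟨fun n t hn _ => ?_, fun r => ⟨_, QMZV.isQMultiZeta_qZeta hq0 hq1 r⟩,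
    fun r n Z Z' hZ hZ' => QMZV.isResidueAlong hq0 hq1 n hZ hZ'⟩
  obtain ⟨n, rfl⟩ := Nat.exists_eq_add_of_le' hn
  rw [QMZV.calL_succ_eq]
  exact QMZV.detD_succ_eq q n t
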